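/- **Setting.** Fix an infinite set from which agents are taken. A *game* is $G=(N,w)$ with a finite set $N$ of agents and rational weights $w(i,j)=w(j,i)$ (possibly negative) on pairs of distinct agents. A *matching* $\mu$ of $N$ is a partition of $N$ into coalitions of size at most $2$; its social welfare is $SW(\mu)=\sum_{C\in\mu}\sum_{i\in C}\sum_{j\in C\setminus\{i\}}w(i,j)$, i.e. twice the total weight of its pairs. An *instance* is a pair $(G,\sigma)$, where $\sigma=(\sigma(1),\dots,\sigma(n))$ is an ordering of $N$ chosen by the adversary. A deterministic *online matching algorithm under free dissolution* produces on $(G,\sigma)$, for each $i=1,\dots,n$, a matching $\pi_i$ of $\{\sigma(1),\dots,\sigma(i)\}$ that depends only on $\sigma(1),\dots,\sigma(i)$ and the subgame induced by these agents. For $i\ge 2$ one of the following must hold: (a) removing $\sigma(i)$ from $\pi_i$ gives $\pi_{i-1}$; or (b) there are $C\in\pi_{i-1}$ and $j\in C$ such that $\pi_i=(\pi_{i-1}\setminus\{C\})\cup\{\{\sigma(i),j\}\}\cup\{\{k\}:k\in C\setminus\{j\}\}$. The output is $\pi_n$. For real $c$, the algorithm is *$c$-competitive* if on every instance the ratio of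 the welfare of its output to the maximum welfare of a matching of $N$ is at least $c$ (with $0/0=1$, and $x/0=0$ for $x<0$). Its *competitive ratio* is the supremum of all such $c$, taken in the extended reals. For $t\ge 1$, the *dissolution threshold algorithm* $t$-DTA starts from the empty matching and proceeds as follows when $i$ arrives and the current matching is $\mu$. It considers the matchings obtained from $\mu$ by matching $i$ to a single agent $j$, and those obtained by replacing a pair $\{j,\ell\}\in\mu$ that satisfies $w(i,j)\ge t\,w(j,\ell)$ by $\{i,j\}$ and $\{\ell\}$. If some considered matching has larger social welfare than $\mu$, it moves to a considered matching of maximum social welfare (ties broken arbitrarily); otherwise it adds $\{i\}$ to $\mu$. **Proposition.** Every deterministic online matching algorithm under free dissolution has competitive ratio at most $\frac{1}{3+2\sqrt2}$. In particular, $\left(1+\frac{\sqrt2}{2}\right)$-DTA is optimal: under every way of breaking ties (and at least one such algorithm exists), it is an online matching algorithm under free dissolution, its competitive ratio is exactly $\frac{1}{3+2\sqrt2}$, and no deterministic online matching algorithm under free dissolution has a larger competitive ratio. -/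

import Mathlib

/-- A finite complete undirected weighted graph `(N, w)` with agents taken from `α`, which gives an
additively separable hedonic game. Only the values of `w` at pairs of distinct agents of `N` are
data; all other values are `0`, so that two games are equal iff they are equal as weighted graphs. -/
structure ASHG (α : Type*) where
  agents : Finset α
  w : α → α → ℚ
  symm : ∀ x y, w x y = w y x
  eq_zero : ∀ x y, ¬ (x ∈ agents ∧ y ∈ agents ∧ x ≠ y) → w x y = 0

namespace ASHG

variable {α : Type*} [DecidableEq α]

/-- The induced subgame `G[S]`. -/
def restrict (G : ASHG α) (S : Finset α) : ASHG α where
  agents := G.agents ∩ S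
  w x y := if x ∈ S ∧ y ∈ S then G.w x y else 0
  symm x y := by simp only [G.symm x y, and_comm]
  eq_zero x y h := by
    by_cases hxy : x ∈ S ∧ y ∈ S
    · rw [if_pos hxy]
      apply G.eq_zero
      rintro ⟨hx, hy, hne⟩
      exact h ⟨Finset.mem_inter.2 ⟨hx, hxy.1⟩, Finset.mem_inter.2 ⟨hy, hxy.2⟩, hne⟩
    · rw [if_neg hxy]

/-- The utility `u_i(C)` of agent `i` for the coalition `C`. -/
def utility (G : ASHG α) (i : α) (C : Finset α) : ℚ :=
  ∑ j ∈ C.erase i, G.w i j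

/-- The social welfare of a partition: the sum of the utilities of all agents, grouped by their
coalitions. -/
def socialWelfare (G : ASHG α) (π : Finset (Finset α)) : ℚ :=
  ∑ C ∈ π, ∑ i ∈ C, G.utility i C

end ASHG

namespace OnlineMatching

variable {α : Type*} [DecidableEq α]

/-- `π` is the set of parts of a partition of `N` (into non-empty coalitions). -/
def IsPartition (N : Finset α) (π : Finset (Finset α)) : Prop :=
  ∃ P : Finpartition N, P.parts = π

/-- A matching of `N` is a partition of `N` into coalitions of size at most `2`. -/
def IsMatching (N : Finset α) (π : Finset (Finset α)) : Prop :=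
  IsPartition N π ∧ ∀ C ∈ π, C.card ≤ 2

/-- The partition `π - i`, i.e. `π` with the agent `i` removed. -/
def remove (π : Finset (Finset α)) (i : α) : Finset (Finset α) :=
  (π.image fun C => C.erase i).filter fun C => C.Nonempty

/-- The partitions available in the standard setting when `i` arrives: `i` joins a coalition of `π`
or forms a new one. -/
def availStandard (π : Finset (Finset α)) (i : α) : Set (Finset (Finset α)) :=
  {π' | IsPartition (insert i (π.sup id)) π' ∧ remove π' i = π}

/-- The partitions available under free dissolution when `i` arrives. -/
def availFreeDissolution (π : Finset (Finset α)) (i : α) : Set (Finset (Finset α)) :=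
  availStandard π i ∪
    {π' | ∃ C ∈ π, ∃ j ∈ C,
      π' = (π \ {C}) ∪ {{i, j}} ∪ (C.erase j).image fun k => {k}}

/-- `(G, σ)` is an instance: `σ` lists the agents of `G` without repetition, in order of arrival. -/
def IsInstance (G : ASHG α) (σ : List α) : Prop :=
  σ.Nodup ∧ σ.toFinset = G.agents

/-- The decision rule of a deterministic online algorithm: it maps the arrived agents, in
order of arrival, and the game among them to a set of coalitions. -/
abbrev Rule (α : Type*) := List α → ASHG α → Finset (Finset α)

/-- The coalitions `π_i` produced by `A` on `(G, σ)` after the first `i` arrivals. The rule is given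
only the first `i` agents and the game `G_i` that they induce. (The games `G_1, …, G_{i-1}`
are induced subgames of `G_i`, and the earlier decisions are determined by them.) -/
def stage (A : Rule α) (G : ASHG α) (σ : List α) (i : ℕ) : Finset (Finset α) :=
  A (σ.take i) (G.restrict (σ.take i).toFinset)

/-- The output `π_n` of `A` on `(G, σ)`. -/
def output (A : Rule α) (G : ASHG α) (σ : List α) : Finset (Finset α) :=
  stage A G σ σ.length

/-- `A` is a (deterministic) online coalition formation algorithm under free dissolution. -/
def IsOnlineAlgorithm (A : Rule α) : Prop :=
  ∀ (G : ASHG α) (σ : List α), IsInstance G σ →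
    (∀ i ≤ σ.length, IsPartition (σ.take i).toFinset (stage A G σ i)) ∧
    ∀ (i : ℕ) (h : i < σ.length), 1 ≤ i →
      stage A G σ (i + 1) ∈ availFreeDissolution (stage A G σ i) σ[i]

/-- `A` is an online matching algorithm under free dissolution: an online coalition formation
algorithm that creates a matching in every step. -/
def IsOnlineMatchingAlgorithm (A : Rule α) : Prop :=
  IsOnlineAlgorithm A ∧
    ∀ (G : ASHG α) (σ : List α), IsInstance G σ →
      ∀ i ≤ σ.length, IsMatching (σ.take i).toFinset (stage A G σ i)

/-- `μ` is a matching of maximum social welfare (equivalently, of maximum weight). -/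
def IsOptimalMatching (G : ASHG α) (μ : Finset (Finset α)) : Prop :=
  IsMatching G.agents μ ∧ ∀ μ', IsMatching G.agents μ' → G.socialWelfare μ' ≤ G.socialWelfare μ

/-- Optimal matchings exist. -/
theorem exists_isOptimalMatching (G : ASHG α) : ∃ μ, IsOptimalMatching G μ := by
  have hfin : {μ | IsMatching G.agents μ}.Finite := by
    refine (G.agents.powerset.powerset.finite_toSet).subset ?_
    rintro μ ⟨⟨P, rfl⟩, -⟩
    simp only [Finset.coe_powerset, Set.mem_preimage, Set.mem_powerset_iff]
    intro C hC
    simpa using P.le hC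
  have hne : {μ | IsMatching G.agents μ}.Nonempty := by
    refine ⟨(⊥ : Finpartition G.agents).parts, ⟨⊥, rfl⟩, ?_⟩
    intro C hC
    obtain ⟨a, -, rfl⟩ := Finpartition.mem_bot_iff.1 hC
    simp
  obtain ⟨μ, hμ, hmax⟩ := Set.exists_max_image _ G.socialWelfare hfin hne
  exact ⟨μ, hμ, hmax⟩

/-- The ratio of an achieved to an optimal welfare, with the conventions `0 / 0 = 1` and
`x / 0 = 0` for `x < 0`. -/
noncomputable def ratio (x y : ℝ) : ℝ :=
  if y = 0 then (if x = 0 then 1 else 0) else x / y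

/-- `A` is `c`-competitive in the matching domain: on every instance, its output has at least `c`
times the welfare of an optimal matching. -/
def IsCompetitive (A : Rule α) (c : ℝ) : Prop :=
  ∀ (G : ASHG α) (σ : List α), IsInstance G σ →
    ∀ μ, IsOptimalMatching G μ →
      c ≤ ratio (G.socialWelfare (output A G σ) : ℝ) (G.socialWelfare μ : ℝ)

/-- The competitive ratio: the supremum (in the extended reals) of all real `c` such that `A` is
`c`-competitive. -/
noncomputable def competitiveRatio (A : Rule α) : EReal :=
  sSup ((fun c : ℝ => (c : EReal)) '' {c | IsCompetitive A c})

/-- The matchings that the dissolution threshold algorithm with parameter `t` considers when `i`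
arrives: match `i` with a single agent `j`, or dissolve a pair `{j, ℓ}` in order to
match `i` with `j`, provided that `w(i, j) ≥ t * w(j, ℓ)`. -/
def availDTA (t : ℝ) (G : ASHG α) (μ : Finset (Finset α)) (i : α) : Set (Finset (Finset α)) :=
  {μ' | ∃ j, {j} ∈ μ ∧ μ' = remove μ j ∪ {{i, j}}} ∪
    {μ' | ∃ j l, j ≠ l ∧ {j, l} ∈ μ ∧ t * (G.w j l : ℝ) ≤ (G.w i j : ℝ) ∧
      μ' = (μ \ {{j, l}}) ∪ {{i, j}, {l}}}

/-- A greedy choice `μ'` from the set `S` of available matchings upon the arrival of `i`: an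
element of `S` of maximum welfare (ties are broken arbitrarily) if some element of `S` improves on
the welfare of `μ`, and `μ` with `i` as a singleton otherwise. -/
def IsGreedyStep (G : ASHG α) (S : Set (Finset (Finset α))) (μ : Finset (Finset α)) (i : α)
    (μ' : Finset (Finset α)) : Prop :=
  ((∃ ν ∈ S, G.socialWelfare μ < G.socialWelfare ν) →
      μ' ∈ S ∧ ∀ ν ∈ S, G.socialWelfare ν ≤ G.socialWelfare μ') ∧
    ((¬ ∃ ν ∈ S, G.socialWelfare μ < G.socialWelfare ν) → μ' = insert {i} μ)

/-- `A` is the dissolution threshold algorithm with parameter `t` (for some way of breaking ties).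
It starts from the empty matching; for `i = 0` the step yields the singleton of the first agent. -/
def IsDTA (t : ℝ) (A : Rule α) : Prop :=
  ∀ (G : ASHG α) (σ : List α), IsInstance G σ →
    stage A G σ 0 = ∅ ∧
    ∀ (i : ℕ) (h : i < σ.length),
      IsGreedyStep G (availDTA t G (stage A G σ i) σ[i]) (stage A G σ i) σ[i]
        (stage A G σ (i + 1))

end OnlineMatching

/-! ### Social welfare of coalitions and induced subgames -/

namespace ASHG

/-! The guarantee for the threshold algorithm is a primal-dual argument. Alongside the run, a
fractional vertex cover `b` of the arrived agents is maintained (`IsDualCertificate`) such that both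
ends of a pair of weight `w` in the current matching have value at least `t * w`. When the newcomer
`i` is matched to `k` with gain `g` in weight, `b i` becomes `t * w(i,k)` and `b k` grows by `t *
g`. The greedy choice makes this a cover again. If a pair was dissolved, the threshold gives `w(i,k)
≤ t/(t-1) * g`, so the cover grows by at most `r * g` with `r = 2t + t/(t-1)`. Weak duality
(`IsMatching.welfare_le_of_cover`) then bounds the optimum by `r` times the output, and `t = 1 +
√2/2` gives `r = 3 + 2√2`.

For the impossibility, suppose that an algorithm is `c`-competitive with `C = 1/c < 3 + 2√2`. The
adversary keeps it at a single pair `{u,v}` of weight `x`, next to a disjoint matching of weight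
`P`. Newcomers arrive alternately for `u` and for `v` with slowly increasing weights, and all their
other weights are prohibitive. The optimum would outgrow `C * x`, so at some weight of about `z` the
algorithm must switch to the newcomer (`IsPosition.round`). The other end of the old pair now has a
partner of weight at least `z`, so the position `(P, x)` becomes about `(P + z, z)`, where `P + 2z ≤
C * x` holds by competitiveness just before. Writing `R = P/x` and `s = z/x`, the new ratio `(R +
s)/s` exceeds `R` by a constant, because `R + s - R*s` stays bounded away from `0` precisely when
`C^2 - 6C + 1 < 0` (`ratio_growth`). But `R ≤ C` always holds, so the rounds cannot go on forever
(`not_isPosition`). -/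

theorem ext_of {α : Type*} {G H : ASHG α} (h₁ : G.agents = H.agents) (h₂ : ∀ x y, G.w x y = H.w x y) :
    G = H := by
  cases G
  cases H
  simp only [ASHG.mk.injEq] at h₁ h₂ ⊢
  exact ⟨h₁, funext fun x => funext fun y => h₂ x y⟩

variable {α : Type*} [DecidableEq α]

/-- The contribution of a single coalition to the social welfare. -/
def coalitionWelfare (G : ASHG α) (C : Finset α) : ℚ :=
  ∑ i ∈ C, G.utility i C

theorem coalitionWelfare_singleton (G : ASHG α) (i : α) : G.coalitionWelfare {i} = 0 := by
  simp [coalitionWelfare, utility]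

theorem coalitionWelfare_pair (G : ASHG α) {i j : α} (h : i ≠ j) :
    G.coalitionWelfare {i, j} = 2 * G.w i j := by
  have h₁ : ({i, j} : Finset α).erase i = {j} := by
    ext x; simp only [Finset.mem_erase, Finset.mem_insert, Finset.mem_singleton]; grind
  have h₂ : ({i, j} : Finset α).erase j = {i} := by
    ext x; simp only [Finset.mem_erase, Finset.mem_insert, Finset.mem_singleton]; grind
  rw [coalitionWelfare, Finset.sum_pair h, utility, utility, h₁, h₂, Finset.sum_singleton,
    Finset.sum_singleton, G.symm j i]
  ring

theorem socialWelfare_insert (G : ASHG α) {π : Finset (Finset α)} {C : Finset α} (h : C ∉ π) :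
    G.socialWelfare (insert C π) = G.coalitionWelfare C + G.socialWelfare π :=
  Finset.sum_insert h

theorem socialWelfare_erase (G : ASHG α) {π : Finset (Finset α)} {C : Finset α} (h : C ∈ π) :
    G.socialWelfare (π.erase C) = G.socialWelfare π - G.coalitionWelfare C := by
  rw [eq_sub_iff_add_eq]
  exact Finset.sum_erase_add _ _ h

theorem socialWelfare_congr {G H : ASHG α} {π : Finset (Finset α)}
    (h : ∀ C ∈ π, ∀ i ∈ C, ∀ j ∈ C, G.w i j = H.w i j) :
    G.socialWelfare π = H.socialWelfare π :=
  Finset.sum_congr rfl fun C hC => Finset.sum_congr rfl fun i hi =>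
    Finset.sum_congr rfl fun j hj => h C hC i hi j (Finset.mem_of_mem_erase hj)

theorem restrict_restrict (G : ASHG α) {S T : Finset α} (h : T ⊆ S) :
    (G.restrict S).restrict T = G.restrict T := by
  refine ext_of ?_ fun x y => ?_
  · simp only [restrict, Finset.inter_assoc, Finset.inter_eq_right.2 h]
  · simp only [restrict]
    by_cases hT : x ∈ T ∧ y ∈ T
    · simp [hT, h hT.1, h hT.2]
    · simp [hT]

theorem restrict_agents (G : ASHG α) : G.restrict G.agents = G := by
  refine ext_of (Finset.inter_self _) fun x y => ?_
  simp only [restrict]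
  split_ifs with h
  · rfl
  · exact (G.eq_zero x y fun h' => h ⟨h'.1, h'.2.1⟩).symm

theorem restrict_w (G : ASHG α) {S : Finset α} {x y : α} (hx : x ∈ S) (hy : y ∈ S) :
    (G.restrict S).w x y = G.w x y := if_pos ⟨hx, hy⟩

end ASHG

/-! ### Matchings: elementary operations, their welfare, and weak duality -/

namespace OnlineMatching

variable {α : Type*} [DecidableEq α]

theorem isPartition_iff {N : Finset α} {π : Finset (Finset α)} :
    IsPartition N π ↔ ∅ ∉ π ∧ (∀ C ∈ π, ∀ D ∈ π, ∀ x ∈ C, x ∈ D → C = D) ∧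
      ∀ x, x ∈ N ↔ ∃ C ∈ π, x ∈ C := by
  constructor
  · rintro ⟨P, rfl⟩
    exact ⟨P.bot_notMem, fun C hC D hD x hx hx' => P.eq_of_mem_parts hC hD hx hx', fun x =>
      ⟨fun hx => P.exists_mem hx, fun ⟨C, hC, hx⟩ => P.le hC hx⟩⟩
  · rintro ⟨h₁, h₂, h₃⟩
    refine ⟨Finpartition.ofExistsUnique π (fun C hC x hx => (h₃ x).2 ⟨C, hC, hx⟩) ?_ h₁, rfl⟩
    intro x hx
    obtain ⟨C, hC, hxC⟩ := (h₃ x).1 hx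
    exact ⟨C, ⟨hC, hxC⟩, fun D hD => h₂ D hD.1 C hC x hD.2 hxC⟩

namespace IsMatching

variable {N : Finset α} {μ : Finset (Finset α)}

theorem empty_notMem (h : IsMatching N μ) : ∅ ∉ μ := (isPartition_iff.1 h.1).1

theorem eq_of_mem (h : IsMatching N μ) {C D : Finset α} (hC : C ∈ μ) (hD : D ∈ μ) {x : α}
    (hx : x ∈ C) (hx' : x ∈ D) : C = D := (isPartition_iff.1 h.1).2.1 C hC D hD x hx hx'

theorem mem_iff (h : IsMatching N μ) (x : α) : x ∈ N ↔ ∃ C ∈ μ, x ∈ C :=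
  (isPartition_iff.1 h.1).2.2 x

theorem mem_of_mem (h : IsMatching N μ) {C : Finset α} (hC : C ∈ μ) {x : α} (hx : x ∈ C) :
    x ∈ N := (h.mem_iff x).2 ⟨C, hC, hx⟩

theorem notMem_of_notMem (h : IsMatching N μ) {C : Finset α} {x : α} (hx : x ∈ C) (hN : x ∉ N) :
    C ∉ μ := fun hC => hN (h.mem_of_mem hC hx)

theorem singleton_or_pair (h : IsMatching N μ) {C : Finset α} (hC : C ∈ μ) :
    (∃ j, C = {j}) ∨ ∃ j l, j ≠ l ∧ C = {j, l} := by
  have h₀ : C.card ≠ 0 := by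
    rw [Finset.card_ne_zero, Finset.nonempty_iff_ne_empty]
    rintro rfl
    exact h.empty_notMem hC
  have h₂ := h.2 C hC
  obtain h' | h' : C.card = 1 ∨ C.card = 2 := by omega
  · exact Or.inl (Finset.card_eq_one.1 h')
  · exact Or.inr (Finset.card_eq_two.1 h')

theorem singleton_or_pair_of_mem (h : IsMatching N μ) {j : α} (hj : j ∈ N) :
    {j} ∈ μ ∨ ∃ l, j ≠ l ∧ {j, l} ∈ μ := by
  obtain ⟨C, hC, hjC⟩ := (h.mem_iff j).1 hj
  obtain ⟨k, rfl⟩ | ⟨k, l, hkl, rfl⟩ := h.singleton_or_pair hC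
  · rw [Finset.mem_singleton] at hjC
    exact Or.inl (hjC ▸ hC)
  · simp only [Finset.mem_insert, Finset.mem_singleton] at hjC
    obtain rfl | rfl := hjC
    · exact Or.inr ⟨l, hkl, hC⟩
    · exact Or.inr ⟨k, hkl.symm, Finset.pair_comm k j ▸ hC⟩

theorem insert_coalition (h : IsMatching N μ) {C : Finset α} (hne : C.Nonempty)
    (hcard : C.card ≤ 2) (hd : Disjoint C N) : IsMatching (C ∪ N) (insert C μ) := by
  rw [Finset.disjoint_left] at hd
  refine ⟨isPartition_iff.2 ⟨?_, ?_, ?_⟩, ?_⟩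
  · rw [Finset.mem_insert, not_or]
    exact ⟨fun h' => hne.ne_empty h'.symm, h.empty_notMem⟩
  · intro D hD E hE x hxD hxE
    rw [Finset.mem_insert] at hD hE
    obtain rfl | hD := hD <;> obtain rfl | hE := hE
    · rfl
    · exact absurd (h.mem_of_mem hE hxE) (hd hxD)
    · exact absurd (h.mem_of_mem hD hxD) (hd hxE)
    · exact h.eq_of_mem hD hE hxD hxE
  · intro x
    simp only [Finset.mem_union, Finset.mem_insert, exists_eq_or_imp, h.mem_iff]
  · intro D hD
    obtain rfl | hD := Finset.mem_insert.1 hD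
    · exact hcard
    · exact h.2 D hD

theorem insert_singleton (h : IsMatching N μ) {i : α} (hi : i ∉ N) :
    IsMatching (insert i N) (insert {i} μ) :=
  h.insert_coalition (Finset.singleton_nonempty i) (by simp) (by simpa using hi)

theorem insert_pair (h : IsMatching N μ) {i j : α} (hi : i ∉ N) (hj : j ∉ N) :
    IsMatching (insert i (insert j N)) (insert {i, j} μ) := by
  have := h.insert_coalition (C := {i, j}) (by simp) Finset.card_le_two (by simp [hi, hj])
  rwa [Finset.insert_union, Finset.singleton_union] at this

theorem erase_coalition (h : IsMatching N μ) {C : Finset α} (hC : C ∈ μ) :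
    IsMatching (N \ C) (μ.erase C) := by
  refine ⟨isPartition_iff.2 ⟨fun h' => h.empty_notMem (Finset.mem_of_mem_erase h'), ?_, ?_⟩,
    fun D hD => h.2 D (Finset.mem_of_mem_erase hD)⟩
  · intro D hD E hE x hxD hxE
    exact h.eq_of_mem (Finset.mem_of_mem_erase hD) (Finset.mem_of_mem_erase hE) hxD hxE
  · intro x
    rw [Finset.mem_sdiff, h.mem_iff]
    constructor
    · rintro ⟨⟨D, hD, hx⟩, hxC⟩
      exact ⟨D, Finset.mem_erase.2 ⟨fun h' => hxC (h' ▸ hx), hD⟩, hx⟩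
    · rintro ⟨D, hD, hx⟩
      obtain ⟨hne, hD⟩ := Finset.mem_erase.1 hD
      exact ⟨⟨D, hD, hx⟩, fun hxC => hne (h.eq_of_mem hD hC hx hxC)⟩

theorem empty : IsMatching (∅ : Finset α) ∅ :=
  ⟨isPartition_iff.2 ⟨by simp, by simp, by simp⟩, by simp⟩

theorem sup_id (h : IsMatching N μ) : μ.sup id = N := by
  ext x
  rw [Finset.mem_sup, h.mem_iff]
  rfl

theorem remove_insert_singleton (h : IsMatching N μ) {i : α} (hi : i ∉ N) :
    remove (insert {i} μ) i = μ := by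
  have h' : μ.image (fun C => C.erase i) = μ := by
    conv_rhs => rw [← Finset.image_id (s := μ)]
    exact Finset.image_congr fun C hC => Finset.erase_eq_of_notMem fun hiC =>
      hi (h.mem_of_mem hC hiC)
  rw [remove, Finset.image_insert, h', Finset.filter_insert, if_neg (by simp)]
  exact Finset.filter_true_of_mem fun C hC =>
    Finset.nonempty_iff_ne_empty.2 fun h₀ => h.empty_notMem (h₀ ▸ hC)

theorem remove_eq_erase (h : IsMatching N μ) {j : α} (hj : {j} ∈ μ) :
    remove μ j = μ.erase {j} := by
  have hj' : j ∉ N \ {j} := by simp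
  conv_lhs => rw [← Finset.insert_erase hj]
  exact (h.erase_coalition hj).remove_insert_singleton hj'

/-- Matching the newcomer `i` to the single agent `j`. -/
theorem match_single (h : IsMatching N μ) {i j : α} (hi : i ∉ N) (hj : {j} ∈ μ) :
    IsMatching (insert i N) (insert {i, j} (μ.erase {j})) := by
  have := (h.erase_coalition hj).insert_pair (i := i) (j := j) (by simp [hi]) (by simp)
  rwa [← Finset.erase_eq, Finset.insert_erase (h.mem_of_mem hj (by simp))] at this

/-- Dissolving the pair `{j, l}` and matching the newcomer `i` to `j`. -/
theorem match_dissolve (h : IsMatching N μ) {i j l : α} (hi : i ∉ N) (hjl : j ≠ l)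
    (hp : {j, l} ∈ μ) :
    IsMatching (insert i N) (insert {l} (insert {i, j} (μ.erase {j, l}))) := by
  have hj : j ∈ N := h.mem_of_mem hp (by simp)
  have hl : l ∈ N := h.mem_of_mem hp (by simp)
  have hil : i ≠ l := fun h' => hi (h' ▸ hl)
  have h₁ := (h.erase_coalition hp).insert_pair (i := i) (j := j) (by simp [hi]) (by simp)
  have h₂ := h₁.insert_singleton (i := l) (by simp [hil.symm, hjl.symm])
  convert h₂ using 1
  ext x
  simp only [Finset.mem_insert, Finset.mem_sdiff, Finset.mem_singleton]
  grind

theorem welfare_insert_singleton (h : IsMatching N μ) (G : ASHG α) {i : α} (hi : i ∉ N) :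
    G.socialWelfare (insert {i} μ) = G.socialWelfare μ := by
  rw [G.socialWelfare_insert (h.notMem_of_notMem (by simp) hi), G.coalitionWelfare_singleton,
    zero_add]

theorem welfare_insert_pair (h : IsMatching N μ) (G : ASHG α) {i j : α} (hi : i ∉ N)
    (hij : i ≠ j) :
    G.socialWelfare (insert {i, j} μ) = G.socialWelfare μ + 2 * G.w i j := by
  rw [G.socialWelfare_insert (h.notMem_of_notMem (x := i) (by simp) hi),
    G.coalitionWelfare_pair hij, add_comm]

theorem welfare_match_single (h : IsMatching N μ) (G : ASHG α) {i j : α} (hi : i ∉ N)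
    (hj : {j} ∈ μ) :
    G.socialWelfare (insert {i, j} (μ.erase {j})) = G.socialWelfare μ + 2 * G.w i j := by
  have hij : i ≠ j := fun h' => hi (h' ▸ h.mem_of_mem hj (by simp))
  rw [(h.erase_coalition hj).welfare_insert_pair G (by simp [hi]) hij, G.socialWelfare_erase hj,
    G.coalitionWelfare_singleton, sub_zero]

theorem welfare_match_dissolve (h : IsMatching N μ) (G : ASHG α) {i j l : α} (hi : i ∉ N)
    (hjl : j ≠ l) (hp : {j, l} ∈ μ) :
    G.socialWelfare (insert {l} (insert {i, j} (μ.erase {j, l}))) =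
      G.socialWelfare μ + 2 * (G.w i j - G.w j l) := by
  have hj : j ∈ N := h.mem_of_mem hp (by simp)
  have hl : l ∈ N := h.mem_of_mem hp (by simp)
  have hij : i ≠ j := fun h' => hi (h' ▸ hj)
  have hil : i ≠ l := fun h' => hi (h' ▸ hl)
  have h₁ := (h.erase_coalition hp).insert_pair (i := i) (j := j) (by simp [hi]) (by simp)
  rw [h₁.welfare_insert_singleton G (by simp [hil.symm, hjl.symm]),
    (h.erase_coalition hp).welfare_insert_pair G (by simp [hi]) hij, G.socialWelfare_erase hp,
    G.coalitionWelfare_pair hjl]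
  ring

/-- Weak duality: fractional vertex covers bound the welfare of matchings. -/
theorem welfare_le_of_cover (h : IsMatching N μ) (G : ASHG α) (b : α → ℝ) (hb : ∀ i, 0 ≤ b i)
    (hw : ∀ i ∈ N, ∀ j ∈ N, i ≠ j → (G.w i j : ℝ) ≤ b i + b j) :
    (G.socialWelfare μ : ℝ) ≤ 2 * ∑ i ∈ N, b i := by
  obtain ⟨P, rfl⟩ := id h.1
  have hs : ∑ i ∈ N, b i = ∑ C ∈ P.parts, ∑ i ∈ C, b i := by
    conv_lhs => rw [← P.biUnion_parts]
    exact Finset.sum_biUnion fun C hC D hD hne => P.disjoint hC hD hne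
  rw [ASHG.socialWelfare, Rat.cast_sum, hs, Finset.mul_sum]
  refine Finset.sum_le_sum fun C hC => ?_
  change ((G.coalitionWelfare C : ℚ) : ℝ) ≤ _
  obtain ⟨j, rfl⟩ | ⟨j, l, hjl, rfl⟩ := h.singleton_or_pair hC
  · rw [G.coalitionWelfare_singleton, Finset.sum_singleton, Rat.cast_zero]
    exact mul_nonneg zero_le_two (hb j)
  · rw [G.coalitionWelfare_pair hjl, Finset.sum_pair hjl]
    push_cast
    have := hw j (h.mem_of_mem hC (by simp)) l (h.mem_of_mem hC (by simp)) hjl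
    linarith

end IsMatching

theorem exists_isMatching_welfare_zero (G : ASHG α) (N : Finset α) :
    ∃ μ, IsMatching N μ ∧ G.socialWelfare μ = 0 := by
  induction N using Finset.induction_on with
  | empty => exact ⟨∅, .empty, rfl⟩
  | insert i N hi ih =>
    obtain ⟨μ, hμ, hw⟩ := ih
    exact ⟨_, hμ.insert_singleton hi, (hμ.welfare_insert_singleton G hi).trans hw⟩

theorem IsOptimalMatching.welfare_nonneg {G : ASHG α} {μ : Finset (Finset α)}
    (h : IsOptimalMatching G μ) : 0 ≤ G.socialWelfare μ := by
  obtain ⟨ν, hν, hw⟩ := exists_isMatching_welfare_zero G G.agents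
  exact hw ▸ h.2 ν hν

end OnlineMatching

/-! ### One step of the threshold algorithm and its dual certificate -/

namespace OnlineMatching

variable {α : Type*} [DecidableEq α]

section Step

variable {t : ℝ} {G : ASHG α} {N : Finset α} {μ μ' : Finset (Finset α)} {i : α}

theorem IsMatching.mem_availDTA_single (h : IsMatching N μ) {j : α} (hj : {j} ∈ μ) :
    insert {i, j} (μ.erase {j}) ∈ availDTA t G μ i :=
  Or.inl ⟨j, hj, by rw [h.remove_eq_erase hj, Finset.union_comm]; rfl⟩

theorem mem_availDTA_dissolve {j l : α} (hjl : j ≠ l) (hp : {j, l} ∈ μ)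
    (ht : t * (G.w j l : ℝ) ≤ (G.w i j : ℝ)) :
    insert {l} (insert {i, j} (μ.erase {j, l})) ∈ availDTA t G μ i := by
  refine Or.inr ⟨j, l, hjl, hp, ht, ?_⟩
  ext D
  simp only [Finset.mem_insert, Finset.mem_erase, Finset.mem_union, Finset.mem_sdiff,
    Finset.mem_singleton]
  tauto

theorem IsMatching.mem_availDTA_iff (h : IsMatching N μ) :
    μ' ∈ availDTA t G μ i ↔
      (∃ j, {j} ∈ μ ∧ μ' = insert {i, j} (μ.erase {j})) ∨
      ∃ j l, j ≠ l ∧ {j, l} ∈ μ ∧ t * (G.w j l : ℝ) ≤ (G.w i j : ℝ) ∧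
        μ' = insert {l} (insert {i, j} (μ.erase {j, l})) := by
  constructor
  · rintro (⟨j, hj, rfl⟩ | ⟨j, l, hjl, hp, ht, rfl⟩)
    · exact Or.inl ⟨j, hj, by rw [h.remove_eq_erase hj, Finset.union_comm]; rfl⟩
    · refine Or.inr ⟨j, l, hjl, hp, ht, ?_⟩
      ext D
      simp only [Finset.mem_insert, Finset.mem_erase, Finset.mem_union, Finset.mem_sdiff,
        Finset.mem_singleton]
      tauto
  · rintro (⟨j, hj, rfl⟩ | ⟨j, l, hjl, hp, ht, rfl⟩)
    · exact h.mem_availDTA_single hj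
    · exact mem_availDTA_dissolve hjl hp ht

/-- This unfolds the greedy rule for the analysis: in every outcome no considered matching beats the
new one, since leaving `i` alone keeps the old welfare. -/
theorem IsMatching.greedyStep_cases (h : IsMatching N μ) (hi : i ∉ N)
    (hs : IsGreedyStep G (availDTA t G μ i) μ i μ') :
    (∀ ν ∈ availDTA t G μ i, G.socialWelfare ν ≤ G.socialWelfare μ') ∧
      (μ' = insert {i} μ ∨
      (∃ j, {j} ∈ μ ∧ 0 < G.w i j ∧ μ' = insert {i, j} (μ.erase {j})) ∨
      ∃ j l, j ≠ l ∧ {j, l} ∈ μ ∧ t * (G.w j l : ℝ) ≤ (G.w i j : ℝ) ∧ G.w j l < G.w i j ∧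
        μ' = insert {l} (insert {i, j} (μ.erase {j, l}))) := by
  by_cases hex : ∃ ν ∈ availDTA t G μ i, G.socialWelfare μ < G.socialWelfare ν
  · obtain ⟨hmem, hmax⟩ := hs.1 hex
    obtain ⟨ν, hν, hlt⟩ := hex
    have hlt := hlt.trans_le (hmax ν hν)
    refine ⟨hmax, Or.inr ?_⟩
    obtain ⟨j, hj, rfl⟩ | ⟨j, l, hjl, hp, ht, rfl⟩ := h.mem_availDTA_iff.1 hmem
    · rw [h.welfare_match_single G hi hj] at hlt
      exact Or.inl ⟨j, hj, by linarith, rfl⟩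
    · rw [h.welfare_match_dissolve G hi hjl hp] at hlt
      exact Or.inr ⟨j, l, hjl, hp, ht, by linarith, rfl⟩
  · obtain rfl := hs.2 hex
    rw [h.welfare_insert_singleton G hi]
    push Not at hex
    exact ⟨hex, Or.inl rfl⟩

theorem IsMatching.greedyStep_isMatching (h : IsMatching N μ) (hi : i ∉ N)
    (hs : IsGreedyStep G (availDTA t G μ i) μ i μ') : IsMatching (insert i N) μ' := by
  obtain ⟨-, rfl | ⟨j, hj, -, rfl⟩ | ⟨j, l, hjl, hp, -, -, rfl⟩⟩ := h.greedyStep_cases hi hs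
  · exact h.insert_singleton hi
  · exact h.match_single hi hj
  · exact h.match_dissolve hi hjl hp

theorem IsMatching.greedyStep_mem_avail (h : IsMatching N μ) (hi : i ∉ N)
    (hs : IsGreedyStep G (availDTA t G μ i) μ i μ') : μ' ∈ availFreeDissolution μ i := by
  obtain ⟨-, rfl | ⟨j, hj, -, rfl⟩ | ⟨j, l, hjl, hp, -, -, rfl⟩⟩ := h.greedyStep_cases hi hs
  · refine Or.inl ⟨?_, h.remove_insert_singleton hi⟩
    rw [h.sup_id]
    exact (h.insert_singleton hi).1
  · refine Or.inr ⟨{j}, hj, j, Finset.mem_singleton_self j, ?_⟩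
    ext D
    simp only [Finset.mem_insert, Finset.mem_erase, Finset.mem_union, Finset.mem_sdiff,
      Finset.mem_singleton, Finset.erase_singleton, Finset.image_empty, Finset.notMem_empty]
    tauto
  · have he : ({j, l} : Finset α).erase j = {l} := by
      ext x
      simp only [Finset.mem_erase, Finset.mem_insert, Finset.mem_singleton]
      grind
    refine Or.inr ⟨{j, l}, hp, j, by simp, ?_⟩
    rw [he]
    ext D
    simp only [Finset.mem_insert, Finset.mem_erase, Finset.mem_union, Finset.mem_sdiff,
      Finset.mem_singleton, Finset.image_singleton]
    tauto

/-- A fractional vertex cover `b` of the positive pairs in `N` that dominates `t` times the weight of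
the pairs in `μ` at each of their agents, and whose size is at most `r` times the weight of `μ`. -/
structure IsDualCertificate (t r : ℝ) (G : ASHG α) (N : Finset α) (μ : Finset (Finset α))
    (b : α → ℝ) : Prop where
  nonneg : ∀ i, 0 ≤ b i
  cover : ∀ i ∈ N, ∀ j ∈ N, i ≠ j → (G.w i j : ℝ) ≤ b i + b j
  weight_nonneg : ∀ i j, i ≠ j → {i, j} ∈ μ → 0 ≤ G.w i j
  dominates : ∀ i j, i ≠ j → {i, j} ∈ μ → t * (G.w i j : ℝ) ≤ b i
  bound : 2 * ∑ i ∈ N, b i ≤ r * G.socialWelfare μ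

theorem IsDualCertificate.empty (t r : ℝ) (G : ASHG α) :
    IsDualCertificate t r G ∅ ∅ fun _ => 0 where
  nonneg _ := le_rfl
  cover := by simp
  weight_nonneg := by simp
  dominates := by simp
  bound := by simp [ASHG.socialWelfare]

/-- An upper bound for the weight of the pairs of the newcomer, given that the greedy step gains
at most `g` in weight. -/
theorem IsDualCertificate.weight_newcomer_le {r : ℝ} {b : α → ℝ} (ht : 1 ≤ t)
    (hb : IsDualCertificate t r G N μ b) (h : IsMatching N μ) (hi : i ∉ N) {g : ℚ} (hg : 0 ≤ g)
    (hgain : ∀ ν ∈ availDTA t G μ i, G.socialWelfare ν ≤ G.socialWelfare μ + 2 * g)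
    {j : α} (hj : j ∈ N) : (G.w i j : ℝ) ≤ g + b j := by
  have hg' : (0 : ℝ) ≤ g := by exact_mod_cast hg
  obtain hs | ⟨l, hjl, hp⟩ := h.singleton_or_pair_of_mem hj
  · have h₁ := hgain _ (h.mem_availDTA_single hs)
    rw [h.welfare_match_single G hi hs] at h₁
    have h₂ : G.w i j ≤ g := by linarith
    have h₃ : (G.w i j : ℝ) ≤ g := by exact_mod_cast h₂
    linarith [hb.nonneg j]
  -- If dissolving `{j, l}` was considered, then `w(i,j) ≤ g + w(j,l)` and `w(j,l) ≤ t * w(j,l) ≤ b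
  -- j`. Otherwise the threshold failed, so already `w(i,j) < t * w(j,l) ≤ b j`.
  · have hd := hb.dominates j l hjl hp
    by_cases hle : t * (G.w j l : ℝ) ≤ (G.w i j : ℝ)
    · have h₁ := hgain _ (mem_availDTA_dissolve hjl hp hle)
      rw [h.welfare_match_dissolve G hi hjl hp] at h₁
      have h₂ : G.w i j ≤ g + G.w j l := by linarith
      have h₃ : (G.w i j : ℝ) ≤ g + G.w j l := by exact_mod_cast h₂
      have h₄ : (0 : ℝ) ≤ G.w j l := by exact_mod_cast hb.weight_nonneg j l hjl hp
      nlinarith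
    · linarith

theorem pair_eq_pair {a b x y : α} (h : ({a, b} : Finset α) = {x, y}) :
    (a = x ∧ b = y) ∨ (a = y ∧ b = x) := by
  have := congrArg (fun s : Finset α => (s : Set α)) h
  simp only [Finset.coe_insert, Finset.coe_singleton] at this
  exact Set.pair_eq_pair_iff.1 this

/-- The certificate is updated at the newcomer `i` and its partner `k` when the pair `{i, k}`
is formed. -/
theorem IsDualCertificate.update {r : ℝ} {b : α → ℝ} (ht : 1 ≤ t)
    (hb : IsDualCertificate t r G N μ b) (hi : i ∉ N) {k : α} (hk : k ∈ N)
    {g : ℚ} (hg : 0 ≤ g) (hgw : g ≤ G.w i k)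
    (hgain : ∀ j ∈ N, (G.w i j : ℝ) ≤ g + b j)
    (hsw : G.socialWelfare μ' = G.socialWelfare μ + 2 * g)
    (hbk : t * (G.w i k : ℝ) ≤ b k + t * g)
    (hr : t * (G.w i k : ℝ) + t * g ≤ r * g)
    (hμ' : ∀ x y, x ≠ y → {x, y} ∈ μ' → ({x, y} : Finset α) = {i, k} ∨
      {x, y} ∈ μ) (hmem : ∀ C ∈ μ, i ∉ C) :
    IsDualCertificate t r G (insert i N) μ'
      (Function.update (Function.update b k (b k + t * g)) i (t * (G.w i k : ℝ))) := by
  have hik : i ≠ k := fun h' => hi (h' ▸ hk)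
  have hg' : (0 : ℝ) ≤ g := by exact_mod_cast hg
  have hgw' : (g : ℝ) ≤ G.w i k := by exact_mod_cast hgw
  have hw : (0 : ℝ) ≤ G.w i k := hg'.trans hgw'
  have ht₀ : 0 ≤ t := by linarith
  have htg : 0 ≤ t * g := mul_nonneg ht₀ hg'
  have htw : (G.w i k : ℝ) ≤ t * G.w i k := by nlinarith
  set b' := Function.update (Function.update b k (b k + t * g)) i (t * (G.w i k : ℝ)) with hb'
  have hbi : b' i = t * G.w i k := Function.update_self ..
  have hbk' : b' k = b k + t * g := by
    rw [hb', Function.update_of_ne hik.symm, Function.update_self]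
  have hbo : ∀ x, x ≠ i → x ≠ k → b' x = b x := fun x hx hx' => by
    rw [hb', Function.update_of_ne hx, Function.update_of_ne hx']
  have hmono : ∀ x, x ≠ i → b x ≤ b' x := by
    intro x hx
    by_cases hx' : x = k
    · rw [hx', hbk']
      linarith
    · rw [hbo x hx hx']
  -- The value of the newcomer pays for the gain: `g ≤ w(i,k) ≤ t * w(i,k) = b' i`.
  have hnew : ∀ j ∈ N, (G.w i j : ℝ) ≤ b' i + b' j := by
    intro j hj
    have h₁ := hgain j hj
    have h₂ := hmono j fun h' => hi (h' ▸ hj)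
    linarith
  refine ⟨fun x => ?_, fun x hx y hy hxy => ?_, fun x y hxy hp => ?_, fun x y hxy hp => ?_, ?_⟩
  · by_cases hx : x = i
    · rw [hx, hbi]
      linarith
    · exact (hb.nonneg x).trans (hmono x hx)
  · rw [Finset.mem_insert] at hx hy
    obtain rfl | hx := hx <;> obtain rfl | hy := hy
    · exact absurd rfl hxy
    · exact hnew y hy
    · rw [G.symm, add_comm]
      exact hnew x hx
    · have h₁ := hb.cover x hx y hy hxy
      have h₂ := hmono x fun h' => hi (h' ▸ hx)
      have h₃ := hmono y fun h' => hi (h' ▸ hy)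
      linarith
  · obtain h' | h' := hμ' x y hxy hp
    · obtain ⟨rfl, rfl⟩ | ⟨rfl, rfl⟩ := pair_eq_pair h'
      · exact hg.trans hgw
      · rw [G.symm]
        exact hg.trans hgw
    · exact hb.weight_nonneg x y hxy h'
  · obtain h' | h' := hμ' x y hxy hp
    · obtain ⟨rfl, rfl⟩ | ⟨rfl, rfl⟩ := pair_eq_pair h'
      · rw [hbi]
      · rw [hbk', G.symm]
        exact hbk
    · refine (hb.dominates x y hxy h').trans (hmono x fun hx => hmem _ h' ?_)
      simp [hx]
  · have h₁ : ∑ x ∈ N, b' x = ∑ x ∈ N, b x + t * g := by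
      rw [← Finset.add_sum_erase N b' hk, ← Finset.add_sum_erase N b hk, hbk',
        Finset.sum_congr rfl fun x hx => hbo x
          (fun h' => hi (h' ▸ Finset.mem_of_mem_erase hx)) (Finset.ne_of_mem_erase hx)]
      ring
    rw [Finset.sum_insert hi, h₁, hbi, hsw]
    push_cast
    have := hb.bound
    linarith

/-- If `i` stays single, the possible gain is `0`, so the old values already cover its pairs. If it
joins a single agent, the gain is `g = w` and the cover grows by `2t * g`. Dissolving a pair is the
critical case, which determines `r`. -/
theorem IsDualCertificate.step {r : ℝ} {b : α → ℝ} (ht : 1 < t) (hr : r = 2 * t + t / (t - 1))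
    (hb : IsDualCertificate t r G N μ b) (h : IsMatching N μ) (hi : i ∉ N)
    (hs : IsGreedyStep G (availDTA t G μ i) μ i μ') :
    ∃ b', IsDualCertificate t r G (insert i N) μ' b' := by
  have ht₀ : 0 < t - 1 := by linarith
  have hmem : ∀ C ∈ μ, i ∉ C := fun C hC hiC => hi (h.mem_of_mem hC hiC)
  obtain ⟨hmax, rfl | ⟨k, hk, hw, rfl⟩ | ⟨k, l, hkl, hp, htw, hw, rfl⟩⟩ := h.greedyStep_cases hi hs
  · rw [h.welfare_insert_singleton G hi] at hmax
    have hold : ∀ x y, x ≠ y → {x, y} ∈ insert {i} μ → {x, y} ∈ μ := by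
      intro x y hxy hxy'
      refine (Finset.mem_insert.1 hxy').resolve_left fun h' => hxy ?_
      have h₁ : x ∈ ({i} : Finset α) := h' ▸ by simp
      have h₂ : y ∈ ({i} : Finset α) := h' ▸ by simp
      rw [Finset.mem_singleton.1 h₁, Finset.mem_singleton.1 h₂]
    have hnew : ∀ j ∈ N, (G.w i j : ℝ) ≤ b j := by
      intro j hj
      simpa using hb.weight_newcomer_le ht.le h hi le_rfl (by simpa using hmax) hj
    -- The certificate leaves `b` arbitrary outside `N`, so the value at `i` has to be set to `0`
    -- explicitly.
    have hbo : ∀ x ∈ N, Function.update b i 0 x = b x := fun x hx =>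
      Function.update_of_ne (fun h' : x = i => hi (h' ▸ hx)) _ _
    refine ⟨Function.update b i 0, fun x => ?_, fun x hx y hy hxy => ?_,
      fun x y hxy hp => hb.weight_nonneg x y hxy (hold x y hxy hp), fun x y hxy hp => ?_, ?_⟩
    · by_cases hx : x = i
      · rw [hx, Function.update_self]
      · rw [Function.update_of_ne hx]
        exact hb.nonneg x
    · rw [Finset.mem_insert] at hx hy
      obtain rfl | hx := hx <;> obtain rfl | hy := hy
      · exact absurd rfl hxy
      · rw [Function.update_self, hbo y hy, zero_add]
        exact hnew y hy
      · rw [Function.update_self, hbo x hx, add_zero, G.symm]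
        exact hnew x hx
      · rw [hbo x hx, hbo y hy]
        exact hb.cover x hx y hy hxy
    · have hp := hold x y hxy hp
      rw [hbo x (h.mem_of_mem hp (by simp))]
      exact hb.dominates x y hxy hp
    · rw [Finset.sum_insert hi, Function.update_self, zero_add, Finset.sum_congr rfl hbo,
        h.welfare_insert_singleton G hi]
      exact hb.bound
  · have hkN : k ∈ N := h.mem_of_mem hk (by simp)
    have hsw := h.welfare_match_single G hi hk
    have hw' : (0 : ℝ) < G.w i k := by exact_mod_cast hw
    rw [hsw] at hmax
    refine ⟨_, hb.update ht.le hi hkN hw.le le_rfl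
      (fun j hj => hb.weight_newcomer_le ht.le h hi hw.le hmax hj) hsw ?_ ?_ ?_ hmem⟩
    · linarith [hb.nonneg k]
    · have : 0 < t / (t - 1) := by positivity
      rw [hr]
      nlinarith
    · intro x y _ hxy
      rw [Finset.mem_insert, Finset.mem_erase] at hxy
      exact hxy.imp_right fun h' => h'.2
  · have hkN : k ∈ N := h.mem_of_mem hp (by simp)
    have hsw := h.welfare_match_dissolve G hi hkl hp
    have hw₀ := hb.weight_nonneg k l hkl hp
    have hg : 0 ≤ G.w i k - G.w k l := by linarith
    rw [hsw] at hmax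
    refine ⟨_, hb.update ht.le hi hkN hg (by linarith)
      (fun j hj => hb.weight_newcomer_le ht.le h hi hg hmax hj) hsw ?_ ?_ ?_ hmem⟩
    · push_cast
      linarith [hb.dominates k l hkl hp]
    · push_cast
      -- A rearrangement of the threshold condition `t * w(k,l) ≤ w(i,k)`. Together with `t²/(t-1) =
      -- t + t/(t-1)` it bounds the increase `t * w(i,k) + t * g` by `r * g`.
      have h₁ : (G.w i k : ℝ) ≤ t / (t - 1) * (G.w i k - G.w k l) := by
        rw [div_mul_eq_mul_div, le_div_iff₀ ht₀]
        linarith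
      have h₂ : t * t / (t - 1) = t + t / (t - 1) := by
        field_simp
        ring
      have h₃ : t * (G.w i k : ℝ) ≤ (t * t / (t - 1)) * (G.w i k - G.w k l) := by
        have := mul_le_mul_of_nonneg_left h₁ (by linarith : 0 ≤ t)
        calc _ ≤ _ := this
          _ = _ := by ring
      rw [h₂] at h₃
      rw [hr]
      linarith
    · intro x y hxy hxy'
      rw [Finset.mem_insert, Finset.mem_insert, Finset.mem_erase] at hxy'
      refine (hxy'.resolve_left fun h' => hxy ?_).imp_right fun h' => h'.2
      have h₁ : x ∈ ({l} : Finset α) := h' ▸ by simp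
      have h₂ : y ∈ ({l} : Finset α) := h' ▸ by simp
      rw [Finset.mem_singleton.1 h₁, Finset.mem_singleton.1 h₂]

end Step

/-! ### Competitiveness of the threshold algorithm over a whole run -/

section Run

variable {t : ℝ} {A : Rule α} {G : ASHG α} {σ : List α}

theorem toFinset_take_succ {i : ℕ} (h : i < σ.length) :
    (σ.take (i + 1)).toFinset = insert σ[i] (σ.take i).toFinset := by
  rw [List.take_succ_eq_append_getElem h, List.toFinset_append, Finset.union_comm]
  rfl

theorem getElem_notMem_take (hσ : σ.Nodup) {i : ℕ} (h : i < σ.length) :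
    σ[i] ∉ (σ.take i).toFinset := by
  have h' : (σ.take (i + 1)).Nodup := hσ.sublist (List.take_sublist _ _)
  rw [List.take_succ_eq_append_getElem h, List.nodup_append] at h'
  rw [List.mem_toFinset]
  exact fun hm => h'.2.2 _ hm _ (by simp) rfl

theorem IsDTA.isMatching_stage (hA : IsDTA t A) (hG : IsInstance G σ) {i : ℕ}
    (hi : i ≤ σ.length) : IsMatching (σ.take i).toFinset (stage A G σ i) := by
  induction i with
  | zero =>
    rw [(hA G σ hG).1]
    exact .empty
  | succ i ih =>
    rw [toFinset_take_succ hi]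
    exact (ih (by omega)).greedyStep_isMatching (getElem_notMem_take hG.1 hi)
      ((hA G σ hG).2 i hi)

theorem IsDTA.isOnlineMatchingAlgorithm (hA : IsDTA t A) : IsOnlineMatchingAlgorithm A :=
  ⟨fun G σ hG => ⟨fun _ hi => (hA.isMatching_stage hG hi).1, fun i hi _ =>
    (hA.isMatching_stage hG hi.le).greedyStep_mem_avail (getElem_notMem_take hG.1 hi)
      ((hA G σ hG).2 i hi)⟩,
    fun _ _ hG _ hi => hA.isMatching_stage hG hi⟩

theorem IsDTA.exists_certificate {r : ℝ} (ht : 1 < t) (hr : r = 2 * t + t / (t - 1))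
    (hA : IsDTA t A) (hG : IsInstance G σ) {i : ℕ} (hi : i ≤ σ.length) :
    ∃ b, IsDualCertificate t r G (σ.take i).toFinset (stage A G σ i) b := by
  induction i with
  | zero =>
    rw [(hA G σ hG).1]
    exact ⟨_, .empty t r G⟩
  | succ i ih =>
    obtain ⟨b, hb⟩ := ih (by omega)
    rw [toFinset_take_succ hi]
    exact hb.step ht hr (hA.isMatching_stage hG (by omega)) (getElem_notMem_take hG.1 hi)
      ((hA G σ hG).2 i hi)

theorem IsDTA.isCompetitive {r : ℝ} (ht : 1 < t) (hr : r = 2 * t + t / (t - 1))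
    (hA : IsDTA t A) : IsCompetitive A (1 / r) := by
  intro G σ hG μ hμ
  have hr₀ : 1 < r := by
    have : 0 < t / (t - 1) := div_pos (by linarith) (by linarith)
    linarith
  obtain ⟨b, hb⟩ := hA.exists_certificate ht hr hG le_rfl
  have hm := hA.isMatching_stage hG le_rfl
  rw [List.take_length, hG.2] at hb hm
  change IsDualCertificate t r G G.agents (output A G σ) b at hb
  have h₁ := hμ.1.welfare_le_of_cover G b hb.nonneg hb.cover
  have h₂ := hb.bound
  have h₃ : (0 : ℝ) ≤ G.socialWelfare μ := by exact_mod_cast hμ.welfare_nonneg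
  have h₄ : (G.socialWelfare (output A G σ) : ℝ) ≤ G.socialWelfare μ := by
    exact_mod_cast hμ.2 _ hm
  unfold ratio
  split_ifs with h₅ h₆
  · rw [div_le_one (by linarith)]
    exact hr₀.le
  -- When the optimum is `0`, the certificate forces the output to have welfare `0` as well, so the
  -- convention `0 / 0 = 1` applies.
  · refine absurd (le_antisymm (h₄.trans h₅.le) ?_) h₆
    by_contra! h
    have := mul_neg_of_pos_of_neg (by linarith : 0 < r) h
    linarith
  · rw [div_le_div_iff₀ (by linarith) (lt_of_le_of_ne h₃ (Ne.symm h₅))]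
    linarith

end Run

/-! ### Existence of the threshold algorithm -/

section Existence

variable {t : ℝ} {G H : ASHG α} {N : Finset α} {μ μ' : Finset (Finset α)} {i : α}

theorem IsMatching.isMatching_of_mem_availDTA (h : IsMatching N μ) (hi : i ∉ N)
    (hμ' : μ' ∈ availDTA t G μ i) : IsMatching (insert i N) μ' := by
  obtain ⟨j, hj, rfl⟩ | ⟨j, l, hjl, hp, -, rfl⟩ := h.mem_availDTA_iff.1 hμ'
  · exact h.match_single hi hj
  · exact h.match_dissolve hi hjl hp

theorem IsMatching.exists_greedyStep (h : IsMatching N μ) (hi : i ∉ N) (t : ℝ) (G : ASHG α) :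
    ∃ μ', IsGreedyStep G (availDTA t G μ i) μ i μ' := by
  by_cases hex : ∃ ν ∈ availDTA t G μ i, G.socialWelfare μ < G.socialWelfare ν
  · have hfin : (availDTA t G μ i).Finite := by
      refine ((insert i N).powerset.powerset.finite_toSet).subset fun ν hν => ?_
      have hν := h.isMatching_of_mem_availDTA hi hν
      rw [Finset.mem_coe, Finset.mem_powerset]
      exact fun C hC => Finset.mem_powerset.2 fun x hx => hν.mem_of_mem hC hx
    obtain ⟨μ', hμ', hmax⟩ := Set.exists_max_image _ G.socialWelfare hfin
      ⟨hex.choose, hex.choose_spec.1⟩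
    exact ⟨μ', fun _ => ⟨hμ', hmax⟩, fun h' => absurd hex h'⟩
  · exact ⟨insert {i} μ, fun h' => absurd h' hex, fun _ => rfl⟩

/-- A rule sees only the subgame of the arrived agents, whereas `IsDTA` compares welfare in the full
game. A greedy step involves no weights beyond those of the arrived agents, so the two agree. -/
theorem IsMatching.greedyStep_congr (h : IsMatching N μ) (hi : i ∉ N)
    (hw : ∀ x ∈ insert i N, ∀ y ∈ insert i N, G.w x y = H.w x y)
    (hs : IsGreedyStep G (availDTA t G μ i) μ i μ') :
    IsGreedyStep H (availDTA t H μ i) μ i μ' := by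
  have hav : availDTA t G μ i = availDTA t H μ i := by
    have hN : ∀ {j l : α}, {j, l} ∈ μ → j ∈ insert i N ∧ l ∈ insert i N := fun hp =>
      ⟨Finset.mem_insert_of_mem (h.mem_of_mem hp (by simp)),
        Finset.mem_insert_of_mem (h.mem_of_mem hp (by simp))⟩
    ext ν
    rw [h.mem_availDTA_iff, h.mem_availDTA_iff]
    refine or_congr_right (exists_congr fun j => exists_congr fun l => and_congr_right fun _ =>
      and_congr_right fun hp => ?_)
    rw [hw j (hN hp).1 l (hN hp).2, hw i (Finset.mem_insert_self i N) j (hN hp).1]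
  have hsw : ∀ {S ν}, IsMatching S ν → S ⊆ insert i N → G.socialWelfare ν = H.socialWelfare ν :=
    fun hν hS => ASHG.socialWelfare_congr fun C hC x hx y hy =>
      hw x (hS (hν.mem_of_mem hC hx)) y (hS (hν.mem_of_mem hC hy))
  have hμ := hsw h (Finset.subset_insert i N)
  have hν : ∀ ν ∈ availDTA t H μ i, G.socialWelfare ν = H.socialWelfare ν := fun ν hν =>
    hsw (h.isMatching_of_mem_availDTA hi hν) subset_rfl
  unfold IsGreedyStep at hs
  rw [hav, hμ] at hs
  refine ⟨fun ⟨ν, hmem, hlt⟩ => ?_, fun hex => hs.2 ?_⟩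
  · obtain ⟨h₁, h₂⟩ := hs.1 ⟨ν, hmem, (hν ν hmem).symm ▸ hlt⟩
    exact ⟨h₁, fun ξ hξ => hν ξ hξ ▸ hν μ' h₁ ▸ h₂ ξ hξ⟩
  · rintro ⟨ν, hmem, hlt⟩
    exact hex ⟨ν, hmem, hν ν hmem ▸ hlt⟩

/-- A run of the dissolution threshold algorithm on the list of arrived agents, the latest of which
comes first. -/
noncomputable def dtaRun (t : ℝ) : List α → ASHG α → Finset (Finset α)
  | [], _ => ∅
  | i :: l, G => Classical.epsilon fun μ' =>
      IsGreedyStep G (availDTA t G (dtaRun t l (G.restrict l.toFinset)) i)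
        (dtaRun t l (G.restrict l.toFinset)) i μ'

theorem isMatching_dtaRun (t : ℝ) {l : List α} (hl : l.Nodup) (G : ASHG α) :
    IsMatching l.toFinset (dtaRun t l G) := by
  induction l generalizing G with
  | nil => exact .empty
  | cons i l ih =>
    rw [List.nodup_cons, ← List.mem_toFinset] at hl
    have h := ih hl.2 (G.restrict l.toFinset)
    rw [List.toFinset_cons]
    exact h.greedyStep_isMatching hl.1 (Classical.epsilon_spec (h.exists_greedyStep hl.1 t G))

theorem greedyStep_dtaRun (t : ℝ) {i : α} {l : List α} (hl : (i :: l).Nodup) (G : ASHG α) :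
    IsGreedyStep G (availDTA t G (dtaRun t l (G.restrict l.toFinset)) i)
      (dtaRun t l (G.restrict l.toFinset)) i (dtaRun t (i :: l) G) := by
  rw [List.nodup_cons, ← List.mem_toFinset] at hl
  exact Classical.epsilon_spec
    ((isMatching_dtaRun t hl.2 (G.restrict l.toFinset)).exists_greedyStep hl.1 t G)

theorem exists_isDTA (t : ℝ) : ∃ A : Rule α, IsDTA t A := by
  refine ⟨fun σ G => dtaRun t σ.reverse G, fun G σ hG => ⟨rfl, fun i hi => ?_⟩⟩
  have hnd : (σ.take (i + 1)).reverse.Nodup :=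
    List.nodup_reverse.2 (hG.1.sublist (List.take_sublist _ _))
  have hrev : (σ.take (i + 1)).reverse = σ[i] :: (σ.take i).reverse := by
    rw [List.take_succ_eq_append_getElem hi, List.reverse_append]
    rfl
  have hsub : (σ.take i).reverse.toFinset ⊆ (σ.take (i + 1)).toFinset := by
    rw [toFinset_take_succ hi, List.toFinset_reverse]
    exact Finset.subset_insert _ _
  rw [hrev] at hnd
  have hs := greedyStep_dtaRun t hnd (G.restrict (σ.take (i + 1)).toFinset)
  rw [G.restrict_restrict hsub, ← hrev] at hs
  rw [List.nodup_cons, ← List.mem_toFinset] at hnd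
  have hm := isMatching_dtaRun t hnd.2 (G.restrict (σ.take i).reverse.toFinset)
  have := hm.greedyStep_congr hnd.1 (H := G) (fun x hx y hy => ?_) hs
  · rw [List.toFinset_reverse] at this
    exact this
  · rw [List.toFinset_reverse, ← toFinset_take_succ hi] at hx hy
    exact G.restrict_w hx hy

end Existence

end OnlineMatching

/-! ### Extending an instance by one agent -/

namespace ASHG

variable {α : Type*} [DecidableEq α]

/-- The game `G` with an additional agent `a` whose weights to the agents of `G` are `f`. -/
def extend (G : ASHG α) (a : α) (ha : a ∉ G.agents) (f : α → ℚ) : ASHG α where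
  agents := insert a G.agents
  w x y := if x = a ∧ y ∈ G.agents then f y else if y = a ∧ x ∈ G.agents then f x else G.w x y
  symm x y := by
    rw [G.symm y x]
    by_cases h₁ : x = a ∧ y ∈ G.agents
    · have h₂ : ¬(y = a ∧ x ∈ G.agents) := fun h => ha (h₁.1 ▸ h.2)
      rw [if_pos h₁, if_neg h₂, if_pos h₁]
    · rw [if_neg h₁, if_neg h₁]
  eq_zero x y h := by
    have h₁ : ¬(x = a ∧ y ∈ G.agents) := by
      rintro ⟨rfl, hy⟩
      exact h ⟨by simp, by simp [hy], fun h' => ha (h' ▸ hy)⟩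
    have h₂ : ¬(y = a ∧ x ∈ G.agents) := by
      rintro ⟨rfl, hx⟩
      exact h ⟨by simp [hx], by simp, fun h' => ha (h' ▸ hx)⟩
    rw [if_neg h₁, if_neg h₂]
    exact G.eq_zero x y fun h' => h
      ⟨Finset.mem_insert_of_mem h'.1, Finset.mem_insert_of_mem h'.2.1, h'.2.2⟩

variable {G : ASHG α} {a : α} {ha : a ∉ G.agents} {f : α → ℚ}

theorem extend_w_new {y : α} (hy : y ∈ G.agents) : (G.extend a ha f).w a y = f y :=
  if_pos ⟨rfl, hy⟩

theorem extend_w_old {x y : α} (hx : x ∈ G.agents) (hy : y ∈ G.agents) :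
    (G.extend a ha f).w x y = G.w x y := by
  have h₁ : ¬(x = a ∧ y ∈ G.agents) := fun h => ha (h.1 ▸ hx)
  have h₂ : ¬(y = a ∧ x ∈ G.agents) := fun h => ha (h.1 ▸ hy)
  simp only [extend, if_neg h₁, if_neg h₂]

theorem extend_restrict : (G.extend a ha f).restrict G.agents = G := by
  refine ext_of (Finset.inter_eq_right.2 (Finset.subset_insert _ _)) fun x y => ?_
  by_cases h : x ∈ G.agents ∧ y ∈ G.agents
  · rw [restrict_w _ h.1 h.2, extend_w_old h.1 h.2]
  · rw [G.eq_zero x y fun h' => h ⟨h'.1, h'.2.1⟩]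
    exact if_neg h

/-- The game without agents. -/
def emptyGame (α : Type*) : ASHG α where
  agents := ∅
  w _ _ := 0
  symm _ _ := rfl
  eq_zero _ _ _ := rfl

end ASHG

namespace OnlineMatching

variable {α : Type*} [DecidableEq α]

section Extend

variable {G : ASHG α} {σ : List α} {a : α} {ha : a ∉ G.agents} {f : α → ℚ}

theorem IsInstance.extend (hG : IsInstance G σ) :
    IsInstance (G.extend a ha f) (σ ++ [a]) := by
  refine ⟨?_, ?_⟩
  · rw [← List.concat_eq_append]
    exact hG.1.concat (by rwa [← List.mem_toFinset, hG.2])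
  · rw [List.toFinset_append, hG.2, Finset.union_comm]
    rfl

/-- This permits an adaptive adversary: weights of later agents cannot affect earlier decisions, so
each newcomer may be designed after seeing the current output. -/
theorem IsInstance.stage_extend (hG : IsInstance G σ) (A : Rule α) :
    stage A (G.extend a ha f) (σ ++ [a]) σ.length = output A G σ := by
  simp only [output, stage, List.take_left', List.take_length, hG.2, ASHG.extend_restrict,
    ASHG.restrict_agents]

/-- Free dissolution leaves a matching algorithm only three kinds of move. In a standard move that
joins `a` to a coalition, the bound on the size forces that coalition to be a single agent. -/
theorem IsMatching.avail_cases {N : Finset α} {π π' : Finset (Finset α)} (h : IsMatching N π)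
    (h' : IsMatching (insert a N) π') (hav : π' ∈ availFreeDissolution π a) :
    π' = insert {a} π ∨ (∃ j, {j} ∈ π ∧ π' = insert {a, j} (π.erase {j})) ∨
      ∃ j l, j ≠ l ∧ {j, l} ∈ π ∧ π' = insert {l} (insert {a, j} (π.erase {j, l})) := by
  obtain ⟨-, rfl⟩ | ⟨C, hC, j, hj, rfl⟩ := hav
  · obtain hs | ⟨j, haj, hp⟩ := h'.singleton_or_pair_of_mem (Finset.mem_insert_self a N)
    · left
      rw [h'.remove_eq_erase hs, Finset.insert_erase hs]
    · right; left
      have hρ := h'.erase_coalition hp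
      have he : ({a, j} : Finset α).erase a = {j} :=
        Finset.erase_insert (by simpa using haj)
      have hrem : remove π' a = insert {j} (π'.erase {a, j}) := by
        have h₁ : (π'.erase {a, j}).image (fun C => C.erase a) = π'.erase {a, j} := by
          conv_rhs => rw [← Finset.image_id (s := π'.erase {a, j})]
          exact Finset.image_congr fun C hC => Finset.erase_eq_of_notMem fun haC => by
            simpa using hρ.mem_of_mem hC haC
        conv_lhs => rw [← Finset.insert_erase hp]
        rw [remove, Finset.image_insert, he, h₁]
        refine Finset.filter_true_of_mem fun C hC => ?_
        obtain rfl | hC := Finset.mem_insert.1 hC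
        · simp
        · exact Finset.nonempty_iff_ne_empty.2 fun h₀ => hρ.empty_notMem (h₀ ▸ hC)
      have hj : {j} ∉ π'.erase {a, j} := hρ.notMem_of_notMem (x := j) (by simp) (by simp)
      refine ⟨j, ?_, ?_⟩
      · rw [hrem]
        exact Finset.mem_insert_self _ _
      · rw [hrem, Finset.erase_insert hj, Finset.insert_erase hp]
  · right
    obtain ⟨k, rfl⟩ | ⟨k, l, hkl, rfl⟩ := h.singleton_or_pair hC
    · left
      rw [Finset.mem_singleton] at hj
      subst hj
      refine ⟨j, hC, ?_⟩
      ext D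
      simp only [Finset.mem_insert, Finset.mem_erase, Finset.mem_union, Finset.mem_sdiff,
        Finset.mem_singleton, Finset.erase_singleton, Finset.image_empty, Finset.notMem_empty]
      tauto
    · right
      have key : ∀ l, j ≠ l → π \ {{j, l}} ∪ {{a, j}} ∪
          (({j, l} : Finset α).erase j).image (fun k => {k}) =
            insert {l} (insert {a, j} (π.erase {j, l})) := by
        intro l hjl
        rw [Finset.erase_insert (by simpa using hjl)]
        ext D
        simp only [Finset.mem_insert, Finset.mem_erase, Finset.mem_union, Finset.mem_sdiff,
          Finset.mem_singleton, Finset.image_singleton]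
        tauto
      simp only [Finset.mem_insert, Finset.mem_singleton] at hj
      obtain rfl | rfl := hj
      · exact ⟨j, l, hkl, hC, key l hkl⟩
      · rw [Finset.pair_comm] at hC ⊢
        exact ⟨j, k, hkl.symm, hC, key k hkl.symm⟩

theorem IsOnlineMatchingAlgorithm.isMatching_output {A : Rule α}
    (hA : IsOnlineMatchingAlgorithm A) (hG : IsInstance G σ) :
    IsMatching G.agents (output A G σ) := by
  have := hA.2 G σ hG σ.length le_rfl
  rwa [List.take_length, hG.2] at this

theorem IsOnlineMatchingAlgorithm.output_extend_cases {A : Rule α}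
    (hA : IsOnlineMatchingAlgorithm A) (hG : IsInstance G σ) (hne : G.agents.Nonempty)
    {π π' : Finset (Finset α)} (hπ : output A G σ = π)
    (hπ' : output A (G.extend a ha f) (σ ++ [a]) = π') :
    π' = insert {a} π ∨ (∃ j, {j} ∈ π ∧ π' = insert {a, j} (π.erase {j})) ∨
      ∃ j l, j ≠ l ∧ {j, l} ∈ π ∧ π' = insert {l} (insert {a, j} (π.erase {j, l})) := by
  subst hπ hπ'
  have hG' : IsInstance (G.extend a ha f) (σ ++ [a]) := hG.extend
  -- The transition rule constrains arrivals only from the second one on.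
  have hlen : 1 ≤ σ.length := by
    rw [Nat.one_le_iff_ne_zero, Ne, List.length_eq_zero_iff]
    rintro rfl
    rw [← hG.2] at hne
    simp at hne
  have h := (hA.1 _ _ hG').2 σ.length (by simp) hlen
  rw [hG.stage_extend, List.getElem_concat_length] at h
  · refine (hA.isMatching_output hG).avail_cases (hA.isMatching_output hG') ?_
    simpa [output] using h
  · rfl

end Extend

/-! ### Positions of the adversary -/

/-- Some matching of `S` has weight at least `p`. -/
def HasWeight (G : ASHG α) (S : Finset α) (p : ℚ) : Prop :=
  ∃ ν, IsMatching S ν ∧ 2 * p ≤ G.socialWelfare ν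

namespace HasWeight

variable {G : ASHG α} {S T : Finset α} {p q : ℚ}

theorem mono (h : HasWeight G S p) (hq : q ≤ p) : HasWeight G S q := by
  obtain ⟨ν, hν, hw⟩ := h
  exact ⟨ν, hν, by linarith⟩

theorem insert_single (h : HasWeight G S p) {i : α} (hi : i ∉ S) (hT : T = insert i S) :
    HasWeight G T p := by
  obtain ⟨ν, hν, hw⟩ := h
  exact ⟨_, hT ▸ hν.insert_singleton hi, by rwa [hν.welfare_insert_singleton G hi]⟩

theorem insert_pair (h : HasWeight G S p) {i j : α} (hi : i ∉ S) (hj : j ∉ S) (hij : i ≠ j)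
    (hT : T = insert i (insert j S)) : HasWeight G T (p + G.w i j) := by
  obtain ⟨ν, hν, hw⟩ := h
  refine ⟨_, hT ▸ hν.insert_pair hi hj, ?_⟩
  rw [hν.welfare_insert_pair G hi hij]
  linarith

theorem extend (h : HasWeight G S p) (hS : S ⊆ G.agents) {a : α} {ha : a ∉ G.agents}
    {f : α → ℚ} : HasWeight (G.extend a ha f) S p := by
  obtain ⟨ν, hν, hw⟩ := h
  refine ⟨ν, hν, hw.trans_eq (ASHG.socialWelfare_congr fun C hC x hx y hy => ?_)⟩
  exact (ASHG.extend_w_old (hS (hν.mem_of_mem hC hx)) (hS (hν.mem_of_mem hC hy))).symm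

end HasWeight

/-- Positivity of `p` keeps the optimum away from `0`, so the conventions in `ratio` play no role.
-/
theorem IsCompetitive.mul_le {A : Rule α} {c p : ℚ} (hA : IsCompetitive A (c : ℝ)) {G : ASHG α}
    {σ : List α} (hG : IsInstance G σ) (hc : 0 ≤ c) (hp : 0 < p)
    (h : HasWeight G G.agents p) : c * (2 * p) ≤ G.socialWelfare (output A G σ) := by
  obtain ⟨ν, hν, hw⟩ := h
  obtain ⟨μ, hμ⟩ := exists_isOptimalMatching G
  have h₁ : 2 * p ≤ G.socialWelfare μ := hw.trans (hμ.2 ν hν)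
  have h₂ : 0 < G.socialWelfare μ := by linarith
  have h₃ := hA G σ hG μ hμ
  rw [ratio, if_neg (by exact_mod_cast h₂.ne'), le_div_iff₀ (by exact_mod_cast h₂)] at h₃
  have h₄ : c * G.socialWelfare μ ≤ G.socialWelfare (output A G σ) := by exact_mod_cast h₃
  exact (mul_le_mul_of_nonneg_left h₁ hc).trans h₄

/-- A position of the adversary: the only pair of the algorithm is `{u, v}`, some matching that
avoids `u` and `v` has weight `P`, and this can be increased by `y₁` and `y₂`, respectively, by
pairs of `u` and of `v` with further agents. -/
structure IsPosition (A : Rule α) (G : ASHG α) (σ : List α) (u v : α) (P y₁ y₂ : ℚ) : Prop where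
  isInstance : IsInstance G σ
  ne : u ≠ v
  pair_mem : {u, v} ∈ output A G σ
  card_eq_one : ∀ C ∈ output A G σ, C ≠ {u, v} → C.card = 1
  weight_sdiff : HasWeight G (G.agents \ {u, v}) P
  weight_erase_left : HasWeight G (G.agents.erase u) (P + y₂)
  weight_erase_right : HasWeight G (G.agents.erase v) (P + y₁)
  weight_agents : HasWeight G G.agents (P + y₁ + y₂)

namespace IsPosition

variable {A : Rule α} {G : ASHG α} {σ : List α} {u v : α} {P y₁ y₂ : ℚ}

theorem swap (h : IsPosition A G σ u v P y₁ y₂) : IsPosition A G σ v u P y₂ y₁ where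
  isInstance := h.isInstance
  ne := h.ne.symm
  pair_mem := Finset.pair_comm u v ▸ h.pair_mem
  card_eq_one C hC hne := h.card_eq_one C hC (Finset.pair_comm u v ▸ hne)
  weight_sdiff := Finset.pair_comm u v ▸ h.weight_sdiff
  weight_erase_left := h.weight_erase_right
  weight_erase_right := h.weight_erase_left
  weight_agents := h.weight_agents.mono (by linarith)

theorem left_mem (hA : IsOnlineMatchingAlgorithm A) (h : IsPosition A G σ u v P y₁ y₂) :
    u ∈ G.agents := (hA.isMatching_output h.isInstance).mem_of_mem h.pair_mem (by simp)

theorem socialWelfare_output (h : IsPosition A G σ u v P y₁ y₂) :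
    G.socialWelfare (output A G σ) = 2 * G.w u v := by
  have h₁ : G.socialWelfare ((output A G σ).erase {u, v}) = 0 := by
    refine Finset.sum_eq_zero fun C hC => ?_
    obtain ⟨hne, hC⟩ := Finset.mem_erase.1 hC
    obtain ⟨j, rfl⟩ := Finset.card_eq_one.1 (h.card_eq_one C hC hne)
    exact G.coalitionWelfare_singleton j
  rw [G.socialWelfare_erase h.pair_mem, G.coalitionWelfare_pair h.ne] at h₁
  linarith

/-- The next newcomer has weight `y` with `u` and very negative weight with all other agents. -/
theorem present [Infinite α] (hA : IsOnlineMatchingAlgorithm A) {c : ℚ} (hc : 0 < c)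
    (hcomp : IsCompetitive A (c : ℝ)) (h : IsPosition A G σ u v P y₁ y₂) (hP : 0 ≤ P)
    (hx : 0 < G.w u v) (y : ℚ) :
    ∃ G' σ', (IsPosition A G' σ' u v P y y₂ ∧ G'.w u v = G.w u v) ∨
      ∃ a, IsPosition A G' σ' a u (P + y₂) 0 0 ∧ G'.w a u = y ∧ c * (P + G.w u v) ≤ y := by
  obtain ⟨a, ha⟩ := Infinite.exists_notMem_finset G.agents
  have hu : u ∈ G.agents := h.left_mem hA
  have hv : v ∈ G.agents := h.swap.left_mem hA
  have hau : a ≠ u := fun h' => ha (h' ▸ hu)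
  have hav : a ≠ v := fun h' => ha (h' ▸ hv)
  have huv := h.ne
  -- The penalty exceeds the whole weight `w(u,v)` of the current matching, so any move pairing `a`
  -- with an agent other than `u` yields negative welfare.
  set G' := G.extend a ha fun z => if z = u then y else -(G.w u v + 1) with hG'
  have hagents : G'.agents = insert a G.agents := rfl
  have hwu : G'.w a u = y := by rw [hG', ASHG.extend_w_new hu, if_pos rfl]
  have hwo : ∀ z ∈ G.agents, z ≠ u → G'.w a z = -(G.w u v + 1) := fun z hz hzu => by
    rw [hG', ASHG.extend_w_new hz, if_neg hzu]
  have hwuv : G'.w u v = G.w u v := ASHG.extend_w_old hu hv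
  have hinst : IsInstance G' (σ ++ [a]) := h.isInstance.extend
  have hm := hA.isMatching_output h.isInstance
  have hSW : G'.socialWelfare (output A G σ) = 2 * G.w u v := by
    rw [← h.socialWelfare_output]
    exact ASHG.socialWelfare_congr fun C hC x hx y hy =>
      ASHG.extend_w_old (hm.mem_of_mem hC hx) (hm.mem_of_mem hC hy)
  have hW₀ : HasWeight G' (G.agents \ {u, v}) P := h.weight_sdiff.extend Finset.sdiff_subset
  have hWu : HasWeight G' (G.agents.erase u) (P + y₂) :=
    h.weight_erase_left.extend (Finset.erase_subset _ _)
  have hW : HasWeight G' G.agents (P + G.w u v) := by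
    rw [← hwuv]
    refine hW₀.insert_pair (by simp) (by simp) huv ?_
    ext z
    simp only [Finset.mem_insert, Finset.mem_sdiff, Finset.mem_singleton]
    grind
  -- Pairing `u` with `v` remains possible offline. This positive bound excludes the penalized moves
  -- and forces `y ≥ c * (P + w(u,v))` upon a switch.
  have hpos := hcomp.mul_le hinst hc.le (by linarith) (hW.insert_single ha hagents)
  have hpos₀ : 0 < c * (P + G.w u v) := mul_pos hc (by linarith)
  refine ⟨G', σ ++ [a], ?_⟩
  obtain h' | ⟨j, hj, h'⟩ | ⟨j, l, hjl, hp, h'⟩ :=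
    hA.output_extend_cases (a := a) (ha := ha)
      (f := fun z => if z = u then y else -(G.w u v + 1)) h.isInstance ⟨u, hu⟩ rfl rfl
  · rw [← hG'] at h'
    refine Or.inl ⟨⟨hinst, huv, ?_, ?_, ?_, ?_, ?_, ?_⟩, hwuv⟩
    · rw [h']
      exact Finset.mem_insert_of_mem h.pair_mem
    · intro C hC hne
      rw [h'] at hC
      obtain rfl | hC := Finset.mem_insert.1 hC
      · simp
      · exact h.card_eq_one C hC hne
    · refine hW₀.insert_single (i := a) (by simp [ha]) ?_
      rw [hagents]
      ext z
      simp only [Finset.mem_insert, Finset.mem_sdiff, Finset.mem_singleton]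
      grind
    · refine hWu.insert_single (i := a) (by simp [ha]) ?_
      rw [hagents]
      ext z
      simp only [Finset.mem_insert, Finset.mem_erase]
      grind
    · rw [← hwu]
      refine hW₀.insert_pair (by simp [ha]) (by simp) hau ?_
      rw [hagents]
      ext z
      simp only [Finset.mem_insert, Finset.mem_sdiff, Finset.mem_singleton, Finset.mem_erase]
      grind
    · rw [← hwu, add_right_comm]
      refine hWu.insert_pair (by simp [ha]) (by simp) hau ?_
      rw [hagents]
      ext z
      simp only [Finset.mem_insert, Finset.mem_erase]
      grind
  · rw [← hG'] at h'
    have hju : j ≠ u := by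
      rintro rfl
      have := hm.eq_of_mem hj h.pair_mem (Finset.mem_singleton_self j) (by simp)
      have hv' : v ∈ ({j} : Finset α) := this ▸ by simp
      exact huv (Finset.mem_singleton.1 hv').symm
    rw [h', hm.welfare_match_single G' ha hj, hSW, hwo j (hm.mem_of_mem hj (by simp)) hju] at hpos
    linarith
  · rw [← hG'] at h'
    have hpair : ({j, l} : Finset α) = {u, v} := by
      by_contra hne
      have := h.card_eq_one _ hp hne
      rw [Finset.card_pair hjl] at this
      omega
    rw [h', hm.welfare_match_dissolve G' ha hjl hp, hSW] at hpos
    obtain ⟨rfl, rfl⟩ | ⟨rfl, rfl⟩ := pair_eq_pair hpair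
    · rw [hwuv, hwu] at hpos
      refine Or.inr ⟨a, ⟨hinst, hau, ?_, ?_, ?_, ?_, ?_, ?_⟩, hwu, by linarith⟩
      · rw [h']
        simp
      · intro C hC hne
        rw [h', Finset.mem_insert, Finset.mem_insert] at hC
        obtain rfl | rfl | hC := hC
        · simp
        · exact absurd rfl hne
        · exact h.card_eq_one C (Finset.mem_of_mem_erase hC) (Finset.ne_of_mem_erase hC)
      -- After the switch to `{a, u}`, the agent `v` is free, so the matching that avoided only `u`
      -- now avoids the whole pair.
      · convert hWu using 1
        rw [hagents]
        ext z
        simp only [Finset.mem_insert, Finset.mem_sdiff, Finset.mem_singleton, Finset.mem_erase]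
        grind
      · rw [add_zero]
        refine hWu.insert_single (i := j) (by simp) ?_
        rw [hagents]
        ext z
        simp only [Finset.mem_insert, Finset.mem_erase]
        grind
      · rw [add_zero]
        refine hWu.insert_single (i := a) (by simp [ha]) ?_
        rw [hagents]
        ext z
        simp only [Finset.mem_insert, Finset.mem_erase]
        grind
      · rw [add_zero, add_zero]
        refine (hWu.insert_single (i := j) (T := G.agents) (by simp) ?_).insert_single ha hagents
        rw [Finset.insert_erase hu]
    · rw [hwo j hv hjl, G'.symm j l, hwuv] at hpos
      linarith

theorem weight_le {c : ℚ} (hc : 0 < c) (hcomp : IsCompetitive A (c : ℝ))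
    (h : IsPosition A G σ u v P y₁ y₂) (hp : 0 < P + y₁ + y₂) :
    c * (P + y₁ + y₂) ≤ G.w u v := by
  have := hcomp.mul_le h.isInstance hc.le hp h.weight_agents
  rw [h.socialWelfare_output] at this
  linarith

/-- One round of the adversary, with weights increasing in steps of `e`. -/
theorem round [Infinite α] (hA : IsOnlineMatchingAlgorithm A) {c : ℚ} (hc : 0 < c)
    (hcomp : IsCompetitive A (c : ℝ)) (h : IsPosition A G σ u v P 0 0) (hP : 0 ≤ P)
    (hx : 0 < G.w u v) {e : ℚ} (he : 0 < e) :
    ∃ G' σ' u' v' P' z, IsPosition A G' σ' u' v' P' 0 0 ∧ 0 ≤ z ∧ P + z ≤ P' ∧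
      G'.w u' v' = z + e ∧ c * (P + G.w u v) ≤ z + e ∧ c * (P + 2 * z) ≤ G.w u v := by
  by_contra hcon
  -- If no switch ever ends the round, the weights offered at both ends grow through all multiples
  -- of `e` while the pair `{u, v}` stays.
  have key : ∀ m : ℕ, ∃ G' σ', IsPosition A G' σ' u v P (m * e) (m * e) ∧ G'.w u v = G.w u v := by
    intro m
    induction m with
    | zero => exact ⟨G, σ, by simpa using h, rfl⟩
    | succ m ih =>
      obtain ⟨G₁, σ₁, h₁, hw₁⟩ := ih
      have hme : 0 ≤ (m : ℚ) * e := by positivity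
      have hle : c * (P + 2 * (m * e)) ≤ G.w u v := by
        rw [← hw₁]
        -- The total may vanish, at the start with `P = 0`, and `weight_le` then does not apply.
        obtain hp | hp := (show 0 ≤ P + m * e + m * e by linarith).lt_or_eq
        · refine (le_of_eq ?_).trans (h₁.weight_le hc hcomp hp)
          ring
        · rw [show P + 2 * (m * e) = 0 by linarith, mul_zero, hw₁]
          exact hx.le
      obtain ⟨G₂, σ₂, ⟨h₂, hw₂⟩ | ⟨a, h₂, hw₂, hc₂⟩⟩ :=
        h₁.present hA hc hcomp hP (hw₁ ▸ hx) ((m + 1 : ℕ) * e)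
      · rw [hw₁] at hw₂
        obtain ⟨G₃, σ₃, ⟨h₃, hw₃⟩ | ⟨a, h₃, hw₃, hc₃⟩⟩ :=
          h₂.swap.present hA hc hcomp hP (by rwa [G₂.symm, hw₂]) ((m + 1 : ℕ) * e)
        · exact ⟨G₃, σ₃, h₃.swap, by rw [G₃.symm, hw₃, G₂.symm, hw₂]⟩
        · rw [G₂.symm, hw₂] at hc₃
          push_cast at hw₃ hc₃ h₃
          -- Here `u` has already received its newcomer of weight `(m+1) * e`, so the secured weight
          -- is even `P + z + e` with `z = m * e`.
          refine absurd ⟨G₃, σ₃, a, v, _, m * e, h₃, hme, ?_, ?_, ?_, hle⟩ hcon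
          · linarith
          · rw [hw₃]
            ring
          · linarith
      · rw [hw₁] at hc₂
        push_cast at hw₂ hc₂
        refine absurd ⟨G₂, σ₂, a, u, _, m * e, h₂, hme, le_rfl, ?_, ?_, hle⟩ hcon
        · rw [hw₂]
          ring
        · linarith
  obtain ⟨m, hm⟩ := exists_nat_gt (G.w u v / (c * e))
  obtain ⟨G₁, σ₁, h₁, hw₁⟩ := key m
  rw [div_lt_iff₀ (mul_pos hc he)] at hm
  have hme : 0 < c * (m * e) := by
    calc 0 < _ := hx
      _ < _ := hm
      _ = _ := by ring
  have hme' : 0 < (m : ℚ) * e := (mul_pos_iff_of_pos_left hc).1 hme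
  have := h₁.weight_le hc hcomp (by linarith)
  rw [hw₁] at this
  nlinarith [mul_nonneg hc.le hP]

end IsPosition

/-! ### Growth of the ratio and the final contradiction -/

/-- In every round of the adversary, the ratio of the secured weight to the weight of the pair of the
algorithm grows by a constant. -/
theorem ratio_growth {C q d R s : ℚ} (hC₁ : 5 ≤ C) (hC₂ : C ≤ 6)
    (hqC : 8 * q = 4 * C - (C - 1) ^ 2) (hd : 0 < d) (hd₁ : d ≤ 1 / 200) (hd₂ : 20 * d ≤ q)
    (hR : 0 ≤ R) (hs : 0 ≤ s) (hs₁ : R + 2 * s ≤ C) (hs₂ : 1 ≤ C * (s + d)) :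
    (R + d) * (s + d) ≤ R + s := by
  have hR₆ : R ≤ 6 := by linarith
  have hs₃ : s ≤ 3 := by linarith
  have h₁ : (R + d) * (s + d) ≤ R * s + 10 * d := by nlinarith
  suffices h₂ : 10 * d ≤ R + s - R * s by linarith
  obtain h | h := le_total 1 R
  -- For `R ≥ 1` the expression decreases in `s`, so the worst case is `s = (C - R)/2`. Completing
  -- the square at `R = (C - 1)/2` leaves at least `q`.
  · have h₃ : R - (R - 1) * ((C - R) / 2) ≤ R + s - R * s := by nlinarith
    nlinarith [sq_nonneg (R - (C - 1) / 2)]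
  -- For `R ≤ 1`, `R + s - R*s = R * 1 + (1 - R) * s` is a convex combination of `1` and `s`, hence
  -- at least `min 1 s`.
  · have h₄ : 1 / 6 ≤ s + d := by nlinarith
    obtain h' | h' := le_total s 1
    · nlinarith [mul_nonneg hR (sub_nonneg.2 h')]
    · nlinarith [mul_nonneg (sub_nonneg.2 h) (sub_nonneg.2 h')]

/-- The growth is used backwards: a bound `P ≤ B * w(u,v)` valid at all positions also holds at the
position after a round, and pulling it back improves `B` by `d`. Iterating makes `B` negative. -/
theorem not_isPosition [Infinite α] {A : Rule α} (hA : IsOnlineMatchingAlgorithm A) {c C : ℚ}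
    (hcC : c * C = 1) (hC₁ : 5 ≤ C) (hC₂ : C ≤ 6) (hC : C ^ 2 - 6 * C + 1 < 0)
    (hcomp : IsCompetitive A (c : ℝ)) {G : ASHG α} {σ : List α} {u v : α} {P : ℚ}
    (h : IsPosition A G σ u v P 0 0) (hP : 0 ≤ P) (hx : 0 < G.w u v) : False := by
  have hC₀ : 0 < C := by linarith
  have hc : 0 < c := pos_of_mul_pos_left (hcC ▸ one_pos) hC₀.le
  obtain ⟨q, hqC⟩ : ∃ q, 8 * q = 4 * C - (C - 1) ^ 2 := ⟨(4 * C - (C - 1) ^ 2) / 8, by ring⟩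
  have hq : 0 < q := by nlinarith
  obtain ⟨d, hd, hd₁, hd₂⟩ : ∃ d : ℚ, 0 < d ∧ d ≤ 1 / 200 ∧ 20 * d ≤ q := by
    refine ⟨min (1 / 200) (q / 20), by positivity, min_le_left _ _, ?_⟩
    linarith [min_le_right (1 / 200) (q / 20)]
  have hmul : ∀ {a b : ℚ}, c * a ≤ b → a ≤ C * b := fun {a b} hab => by
    have := mul_le_mul_of_nonneg_left hab hC₀.le
    rwa [← mul_assoc, mul_comm C c, hcC, one_mul] at this
  have key : ∀ (n : ℕ) (G : ASHG α) (σ : List α) (u v : α) (P : ℚ), IsPosition A G σ u v P 0 0 →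
      0 ≤ P → 0 < G.w u v → P ≤ (C - n * d) * G.w u v := by
    intro n
    induction n with
    | zero =>
      intro G σ u v P h hP hx
      rw [Nat.cast_zero, zero_mul, sub_zero]
      obtain rfl | hP := hP.eq_or_lt
      · positivity
      · have := h.weight_le hc hcomp (by simpa using hP)
        rw [add_zero, add_zero] at this
        exact hmul this
    | succ n ih =>
      intro G σ u v P h hP hx
      -- The increment `e = d * x` is proportional to the current weight, so the loss in the
      -- scale-free quantities `P/x` and `z/x` is the same in every round.
      obtain ⟨G', σ', u', v', P', z, h', hz, hP', hw, h₁, h₂⟩ :=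
        h.round hA hc hcomp hP hx (mul_pos hd hx)
      have hpos : 0 < z + d * G.w u v := by positivity
      have h₃ := ih G' σ' u' v' P' h' (by linarith) (hw ▸ hpos)
      rw [hw] at h₃
      have h₄ := hmul h₁
      have h₅ := hmul h₂
      set x := G.w u v
      have h₆ : (P / x + d) * (z / x + d) ≤ P / x + z / x := by
        refine ratio_growth hC₁ hC₂ hqC hd hd₁ hd₂ (by positivity) (by positivity) ?_ ?_
        · rw [mul_div_assoc', ← add_div, div_le_iff₀ hx]
          exact h₅
        · rw [div_add' _ _ _ hx.ne', mul_div_assoc', le_div_iff₀ hx]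
          linarith
      have h₇ : (P + d * x) * (z + d * x) ≤ (P + z) * x := by
        have := mul_le_mul_of_nonneg_right h₆ (mul_pos hx hx).le
        field_simp at this
        nlinarith
      have h₈ : (P + d * x) * (z + d * x) ≤ (C - n * d) * x * (z + d * x) := by
        nlinarith
      have h₉ := le_of_mul_le_mul_right h₈ hpos
      push_cast
      linarith
  obtain ⟨n, hn⟩ := exists_nat_gt (C / d)
  rw [div_lt_iff₀ hd] at hn
  have := key n G σ u v P h hP hx
  nlinarith

/-- If the algorithm is competitive, it forms a pair of weight `1` between the first two agents. -/
theorem exists_isPosition [Infinite α] {A : Rule α} (hA : IsOnlineMatchingAlgorithm A) {c : ℚ}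
    (hc : 0 < c) (hcomp : IsCompetitive A (c : ℝ)) :
    ∃ G σ u v, IsPosition A G σ u v 0 0 0 ∧ G.w u v = 1 := by
  obtain ⟨v, -⟩ := Infinite.exists_notMem_finset (∅ : Finset α)
  obtain ⟨u, huv⟩ := Infinite.exists_notMem_finset ({v} : Finset α)
  rw [Finset.mem_singleton] at huv
  have hv : v ∉ (ASHG.emptyGame α).agents := Finset.notMem_empty v
  set G₁ := (ASHG.emptyGame α).extend v hv fun _ => 0
  have hu : u ∉ G₁.agents := by
    change u ∉ insert v ∅
    simpa using huv
  set G := G₁.extend u hu fun _ => 1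
  have hagents : G.agents = {u, v} := rfl
  have hw : G.w u v = 1 := ASHG.extend_w_new (Finset.mem_insert_self v _)
  have h₀ : IsInstance (ASHG.emptyGame α) [] := ⟨List.nodup_nil, rfl⟩
  have hG : IsInstance G (([] ++ [v]) ++ [u]) := h₀.extend.extend
  have hm := hA.isMatching_output hG
  have hW : HasWeight G ∅ 0 := ⟨∅, .empty, by simp [ASHG.socialWelfare]⟩
  have hWG : HasWeight G G.agents 1 := by
    have := hW.insert_pair (i := u) (j := v) (T := G.agents) (by simp) (by simp) huv rfl
    rwa [hw, zero_add] at this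
  have hpos := hcomp.mul_le hG hc.le one_pos hWG
  have hmem : {u, v} ∈ output A G (([] ++ [v]) ++ [u]) := by
    obtain hs | ⟨l, hul, hp⟩ := hm.singleton_or_pair_of_mem (j := u) (by simp [hagents])
    · obtain hs' | ⟨l, hvl, hp⟩ := hm.singleton_or_pair_of_mem (j := v) (by simp [hagents])
      · have hz : G.socialWelfare (output A G (([] ++ [v]) ++ [u])) = 0 := by
          refine Finset.sum_eq_zero fun C hC => ?_
          obtain ⟨j, rfl⟩ | ⟨j, l, hjl, rfl⟩ := hm.singleton_or_pair hC
          · exact G.coalitionWelfare_singleton j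
          · exfalso
            have hj := hm.mem_of_mem hC (x := j) (by simp)
            rw [hagents, Finset.mem_insert, Finset.mem_singleton] at hj
            have : ∀ k, {k} ∈ output A G (([] ++ [v]) ++ [u]) → j ≠ k := by
              rintro k hk rfl
              have h₁ := hm.eq_of_mem hC hk (x := j) (by simp) (by simp)
              have h₂ := congrArg Finset.card h₁
              rw [Finset.card_pair hjl, Finset.card_singleton] at h₂
              omega
            exact hj.elim (this u hs) (this v hs')
        rw [hz] at hpos
        linarith
      · have hl := hm.mem_of_mem hp (x := l) (by simp)
        rw [hagents, Finset.mem_insert, Finset.mem_singleton] at hl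
        obtain rfl := hl.resolve_right hvl.symm
        rwa [Finset.pair_comm]
    · have hl := hm.mem_of_mem hp (x := l) (by simp)
      rw [hagents, Finset.mem_insert, Finset.mem_singleton] at hl
      obtain rfl := hl.resolve_left hul.symm
      exact hp
  refine ⟨G, _, u, v, ⟨hG, huv, hmem, fun C hC hne => ?_, ?_, ?_, ?_, ?_⟩, hw⟩
  · obtain ⟨j, rfl⟩ | ⟨j, l, -, rfl⟩ := hm.singleton_or_pair hC
    · simp
    · have hj := hm.mem_of_mem hC (x := j) (by simp)
      exact absurd (hm.eq_of_mem hC hmem (by simp) hj) hne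
  · rwa [hagents, Finset.sdiff_self]
  · exact hW.insert_single (i := v) (by simp) (by
      rw [hagents, Finset.erase_insert (by simpa using huv)]; rfl) |>.mono (by simp)
  · exact hW.insert_single (i := u) (by simp) (by
      rw [hagents, Finset.pair_comm, Finset.erase_insert (by simpa using Ne.symm huv)]; rfl) |>.mono (by simp)
  · exact hWG.mono (by norm_num)

/-- A rational `c` is inserted because the increments of the adversary are weights of the game. It
is also kept below `1/5`, so that `C = 1/c` lies between `5` and `3 + 2√2`, the larger root of `X^2
- 6X + 1`. -/
theorem competitiveRatio_le [Infinite α] {A : Rule α} (hA : IsOnlineMatchingAlgorithm A) :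
    competitiveRatio A ≤ ((1 / (3 + 2 * Real.sqrt 2) : ℝ) : EReal) := by
  refine sSup_le ?_
  rintro _ ⟨c₀, hc₀, rfl⟩
  rw [EReal.coe_le_coe_iff]
  by_contra! hlt
  have hs : Real.sqrt 2 ^ 2 = 2 := Real.sq_sqrt zero_le_two
  have hs₁ : 1 < Real.sqrt 2 := by
    nlinarith [Real.sqrt_nonneg 2]
  have hs₂ : Real.sqrt 2 < 3 / 2 := by
    nlinarith [Real.sqrt_nonneg 2]
  have h₅ : (1 / (3 + 2 * Real.sqrt 2) : ℝ) < 1 / 5 :=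
    one_div_lt_one_div_of_lt (by norm_num) (by linarith)
  obtain ⟨c, hc₁, hc₂⟩ := exists_rat_btwn (lt_min hlt h₅)
  have hcomp : IsCompetitive A (c : ℝ) := fun G σ hG μ hμ =>
    (hc₂.le.trans (min_le_left _ _)).trans (hc₀ G σ hG μ hμ)
  have hc₃ : (c : ℝ) < 1 / 5 := hc₂.trans_le (min_le_right _ _)
  have hr : (0 : ℝ) < 3 + 2 * Real.sqrt 2 := by linarith
  have hc₄ : (0 : ℝ) < c := (one_div_pos.2 hr).trans hc₁
  have hc : 0 < c := by exact_mod_cast hc₄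
  have hC₁ : (5 : ℝ) < 1 / c := (lt_one_div hc₄ (by norm_num)).1 hc₃
  have hC₂ : (1 / c : ℝ) < 3 + 2 * Real.sqrt 2 := (one_div_lt hr hc₄).1 hc₁
  have hC : (1 / c : ℝ) ^ 2 - 6 * (1 / c) + 1 < 0 := by
    nlinarith
  obtain ⟨G, σ, u, v, h, hw⟩ := exists_isPosition hA hc hcomp
  refine not_isPosition hA (C := 1 / c) (mul_one_div_cancel hc.ne') ?_ ?_ ?_ hcomp h le_rfl
    (hw ▸ one_pos)
  · exact_mod_cast hC₁.le
  · have : (1 / c : ℝ) ≤ 6 := by linarith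
    exact_mod_cast this
  · exact_mod_cast hC

theorem IsDTA.competitiveRatio_eq [Infinite α] {A : Rule α}
    (hA : IsDTA (1 + Real.sqrt 2 / 2) A) :
    competitiveRatio A = ((1 / (3 + 2 * Real.sqrt 2) : ℝ) : EReal) := by
  refine le_antisymm (competitiveRatio_le hA.isOnlineMatchingAlgorithm) (le_sSup ⟨_, ?_, rfl⟩)
  have hs : Real.sqrt 2 ^ 2 = 2 := Real.sq_sqrt zero_le_two
  have hs₀ : 0 < Real.sqrt 2 := Real.sqrt_pos.2 zero_lt_two
  refine hA.isCompetitive (by linarith) ?_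
  rw [add_sub_cancel_left]
  field_simp
  nlinarith

end OnlineMatching

theorem mainTheorem6 {α : Type*} [DecidableEq α] [Infinite α] :
    (∀ A : OnlineMatching.Rule α, OnlineMatching.IsOnlineMatchingAlgorithm A →
      OnlineMatching.competitiveRatio A ≤ ((1 / (3 + 2 * Real.sqrt 2) : ℝ) : EReal)) ∧
    (∃ A : OnlineMatching.Rule α, OnlineMatching.IsDTA (1 + Real.sqrt 2 / 2) A) ∧
    (∀ A : OnlineMatching.Rule α, OnlineMatching.IsDTA (1 + Real.sqrt 2 / 2) A →
      OnlineMatching.IsOnlineMatchingAlgorithm A ∧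
      OnlineMatching.competitiveRatio A = ((1 / (3 + 2 * Real.sqrt 2) : ℝ) : EReal) ∧
      ∀ B : OnlineMatching.Rule α, OnlineMatching.IsOnlineMatchingAlgorithm B →
        OnlineMatching.competitiveRatio B ≤ OnlineMatching.competitiveRatio A) :=
  ⟨fun _ hA => OnlineMatching.competitiveRatio_le hA, OnlineMatching.exists_isDTA _,
    fun _ hA => ⟨hA.isOnlineMatchingAlgorithm, hA.competitiveRatio_eq, fun _ hB =>
      hA.competitiveRatio_eq ▸ OnlineMatching.competitiveRatio_le hB⟩⟩
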